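/- Let $1\le m<n$ be integers and let $F\subseteq\mathbb R^n$ be non-empty. For a non-empty bounded set $E\subseteq\mathbb R^n$ let $N_r(E)$ be the least number of sets of diameter at most $r$ that cover $E$, and let $$\underline{\dim}_{\mathrm B}E=\liminf_{r\to0}\frac{\log N_r(E)}{-\log r},\qquad \overline{\dim}_{\mathrm B}E=\limsup_{r\to0}\frac{\log N_r(E)}{-\log r}$$ be its lower and upper box dimensions. The packing dimension of a (not necessarily bounded) set $E$ is $$\dim_{\mathrm P}E=\inf\Big\{\sup_j\overline{\dim}_{\mathrm B}E_j : E\subseteq\bigcup_{j=1}^\infty E_j,\ E_j\text{ compact}\Big\}.$$ For $\theta\in(0,1)$, the upper Assouad spectrum $\overline{\dim}{}_{\mathrm A}^{\theta}F$ is the infimum of all $\alpha$ for which there is $C>0$ with $N_r(B(x,R)\cap F)\le C(R/r)^\alpha$ for all $x\in F$ and all $0<r\le R^{1/\theta}<R<1$, where $B(x,R)$ is the closed ball of centre $x$ and radius $R$. The quasi-Assouad dimension is $\dim_{\mathrm{qA}}F=\lim_{\theta\nearrow1}\overline{\dim}{}_{\mathrm A}^{\theta}F$. Let $G(n,m)$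 be the Grassmannian of $m$-dimensional linear subspaces of $\mathbb R^n$; "almost all $V\in G(n,m)$" refers to its rotation-invariant Borel probability measure, and $\pi_V$ is the orthogonal projection onto $V$. (1) Suppose that $F$ is bounded and let $\dim$ be either one of $\overline{\dim}_{\mathrm B}$ and $\underline{\dim}_{\mathrm B}$. Then, for almost all $V\in G(n,m)$, $$\dim\pi_VF\ \ge\ \dim F-\max\{0,\ \dim_{\mathrm{qA}}F-m\}.$$ If moreover $\dim_{\mathrm{qA}}F\le\max\{m,\dim F\}$, then, for almost all $V\in G(n,m)$, $$\dim\pi_VF=\min\{m,\dim F\}.$$ (2) Suppose that $F$ is a Borel set, bounded or not. Then both conclusions of (1) hold with $\dim=\dim_{\mathrm P}$: for almost all $V\in G(n,m)$ one has $\dim_{\mathrm P}\pi_VF\ge\dim_{\mathrm P}F-\max\{0,\dim_{\mathrm{qA}}F-m\}$, and if $\dim_{\mathrm{qA}}F\le\max\{m,\dim_{\mathrm P}F\}$, then, for almost all $V\in G(n,m)$, $\dim_{\mathrm P}\pi_VF=\min\{m,\dim_{\mathrm P}F\}$. -/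

import Mathlib

open Set Filter Topology MeasureTheory
open scoped ENNReal

noncomputable section

namespace ProjDim

/-! ### Covering numbers, box dimensions and packing dimension -/

/-- `N_r(F)`: the least number of sets of diameter at most `r` that cover `F`
(`⊤` if no finite family does). -/
def coverNum {X : Type*} [PseudoEMetricSpace X] (r : ℝ) (F : Set X) : ℕ∞ :=
  ⨅ (C : Finset (Set X)) (_ : F ⊆ ⋃ U ∈ C, U)
    (_ : ∀ U ∈ C, Metric.ediam U ≤ ENNReal.ofReal r), (C.card : ℕ∞)

/-- The ratio `log N_r(F) / (- log r)`. -/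
def boxRatio {X : Type*} [PseudoEMetricSpace X] (F : Set X) (r : ℝ) : EReal :=
  ENNReal.log (coverNum r F : ℝ≥0∞) / ((-Real.log r : ℝ) : EReal)

/-- Lower box dimension. -/
def lowerBoxDim {X : Type*} [PseudoEMetricSpace X] (F : Set X) : EReal :=
  liminf (boxRatio F) (𝓝[>] (0 : ℝ))

/-- Upper box dimension. -/
def upperBoxDim {X : Type*} [PseudoEMetricSpace X] (F : Set X) : EReal :=
  limsup (boxRatio F) (𝓝[>] (0 : ℝ))

/-- Packing dimension: the infimum of `sup_j (upper box dimension of K_j)` over countable covers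
of `F` by compact sets `K_j`. -/
def packingDim {X : Type*} [PseudoEMetricSpace X] (F : Set X) : EReal :=
  ⨅ (K : ℕ → Set X) (_ : ∀ j, IsCompact (K j)) (_ : F ⊆ ⋃ j, K j), ⨆ j, upperBoxDim (K j)

/-! ### Upper Assouad spectrum and quasi-Assouad dimension -/

/-- The exponents admitted in the definition of the upper Assouad spectrum at `θ`. -/
def IsSpectrumExponent {X : Type*} [PseudoMetricSpace X] (θ : ℝ) (F : Set X) (α : ℝ) : Prop :=
  ∃ C : ℝ, 0 < C ∧ ∀ r R : ℝ, 0 < r → r ≤ R ^ (1 / θ) → R ^ (1 / θ) < R → R < 1 →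
    ∀ x ∈ F, (coverNum r (Metric.closedBall x R ∩ F) : ℝ≥0∞) ≤ ENNReal.ofReal (C * (R / r) ^ α)

/-- The upper Assouad spectrum at `θ ∈ (0,1)`. -/
def upperAssouadSpectrum {X : Type*} [PseudoMetricSpace X] (θ : ℝ) (F : Set X) : EReal :=
  ⨅ (α : ℝ) (_ : IsSpectrumExponent θ F α), (α : EReal)

/-- The quasi-Assouad dimension: the limit of the upper Assouad spectrum as `θ` increases to `1`.
It is written as an upper limit; `tendsto_quasiAssouadDim` shows that it is a limit. -/
def quasiAssouadDim {X : Type*} [PseudoMetricSpace X] (F : Set X) : EReal :=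
  limsup (fun θ : ℝ => upperAssouadSpectrum θ F) (𝓝[<] (1 : ℝ))

theorem upperAssouadSpectrum_mono {X : Type*} [PseudoMetricSpace X] (F : Set X) {θ θ' : ℝ}
    (h0 : 0 < θ) (h : θ ≤ θ') (h1 : θ' < 1) :
    upperAssouadSpectrum θ F ≤ upperAssouadSpectrum θ' F := by
  refine le_iInf₂ fun α hα => iInf₂_le α ?_
  obtain ⟨C, hC, H⟩ := hα
  refine ⟨C, hC, fun r R hr hrR hRR hR1 x hx => ?_⟩
  have h0' : 0 < θ' := h0.trans_le h
  have hR0 : 0 < R := (hr.trans_le hrR).trans hRR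
  have hinv : 1 / θ' ≤ 1 / θ := one_div_le_one_div_of_le h0 h
  refine H r R hr (hrR.trans (Real.rpow_le_rpow_of_exponent_ge hR0 hR1.le hinv)) ?_ hR1 x hx
  calc R ^ (1 / θ') < R ^ (1 : ℝ) :=
        Real.rpow_lt_rpow_of_exponent_gt hR0 hR1 ((one_lt_div h0').2 h1)
    _ = R := Real.rpow_one R

theorem tendsto_quasiAssouadDim {X : Type*} [PseudoMetricSpace X] (F : Set X) :
    Tendsto (fun θ : ℝ => upperAssouadSpectrum θ F) (𝓝[<] (1 : ℝ)) (𝓝 (quasiAssouadDim F)) := by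
  have h01 : (0 : ℝ) < 1 := one_pos
  have hmono : MonotoneOn (fun θ : ℝ => upperAssouadSpectrum θ F) (Ioo 0 1) :=
    fun a ha b hb hab => upperAssouadSpectrum_mono F ha.1 hab hb.2
  have key := hmono.tendsto_nhdsWithin_Ioo_left (nonempty_Ioo.2 h01) (OrderTop.bddAbove _)
  have : quasiAssouadDim F = sSup ((fun θ : ℝ => upperAssouadSpectrum θ F) '' Ioo 0 1) :=
    key.limsup_eq
  rw [this]
  exact key

/-! ### The Grassmannian and its invariant measure -/

/-- Euclidean space `ℝⁿ`. -/
abbrev E (n : ℕ) : Type := EuclideanSpace ℝ (Fin n)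

/-- The orthogonal group `O(n)`, as a subgroup of the linear operators on `ℝⁿ` with the topology
of the operator norm. -/
abbrev O (n : ℕ) : Type := unitary (E n →L[ℝ] E n)

instance instContinuousStarO (n : ℕ) : ContinuousStar (E n →L[ℝ] E n) :=
  ⟨(ContinuousLinearMap.adjoint (𝕜 := ℝ) (E := E n) (F := E n)).continuous⟩

instance instCompactSpaceO (n : ℕ) : CompactSpace (O n) := by
  have : ProperSpace (E n →L[ℝ] E n) := FiniteDimensional.proper ℝ _
  refine isCompact_iff_compactSpace.1
    (Metric.isCompact_of_isClosed_isBounded (isClosed_unitary (R := E n →L[ℝ] E n)) ?_)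
  refine (Metric.isBounded_closedBall (x := (0 : E n →L[ℝ] E n)) (r := 1)).subset fun u hu => ?_
  rw [mem_closedBall_zero_iff]
  refine ContinuousLinearMap.opNorm_le_bound _ zero_le_one fun x => ?_
  rw [one_mul]
  exact (Unitary.norm_map (⟨u, hu⟩ : O n) x).le

/-- The Grassmannian `G(n,m)` of `m`-dimensional linear subspaces of `ℝⁿ`. -/
def Gr (n m : ℕ) : Type := {V : Submodule ℝ (E n) // Module.finrank ℝ V = m}

/-- The usual topology of `G(n,m)`, given by the metric `‖π_V - π_W‖`. -/
instance instTopologicalSpaceGr (n m : ℕ) : TopologicalSpace (Gr n m) :=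
  TopologicalSpace.induced (fun V => V.1.starProjection) inferInstance

/-- The Borel sets of `G(n,m)`. -/
instance instMeasurableSpaceGr (n m : ℕ) : MeasurableSpace (Gr n m) := borel _

instance instBorelSpaceGr (n m : ℕ) : BorelSpace (Gr n m) := ⟨rfl⟩

/-- The action of `O(n)` on `G(n,m)`: `(g, V) ↦ g V`. -/
def rotate {n m : ℕ} (g : O n) (V : Gr n m) : Gr n m :=
  ⟨V.1.map (Unitary.linearIsometryEquiv g).toLinearEquiv.toLinearMap, by
    rw [LinearEquiv.finrank_map_eq]; exact V.2⟩

/-- The subspace of `ℝⁿ` spanned by the first `m` coordinate vectors. -/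
def coordSubspace {n m : ℕ} (h : m ≤ n) : Gr n m :=
  ⟨Submodule.span ℝ (range fun i : Fin m =>
      (EuclideanSpace.single (Fin.castLE h i) (1 : ℝ) : E n)), by
    have hli : LinearIndependent ℝ (fun i : Fin m =>
        (EuclideanSpace.single (Fin.castLE h i) (1 : ℝ) : E n)) :=
      ((EuclideanSpace.orthonormal_single (𝕜 := ℝ) (ι := Fin n)).comp _
        (Fin.castLE_injective h)).linearIndependent
    rw [finrank_span_eq_card hli, Fintype.card_fin]⟩

/-- The natural invariant probability measure on `G(n,m)`: the image of the normalized Haar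
measure of `O(n)` under `g ↦ g V₀`, where `V₀` is spanned by the first `m` coordinate vectors. -/
def grMeasure {n m : ℕ} (h : m ≤ n) : Measure (Gr n m) :=
  (Measure.haarMeasure (⊤ : TopologicalSpace.PositiveCompacts (O n))).map
    fun g => rotate g (coordSubspace h)

theorem starProjection_rotate {n m : ℕ} (g : O n) (V : Gr n m) :
    (rotate g V).1.starProjection =
      (g : E n →L[ℝ] E n) * V.1.starProjection * star (g : E n →L[ℝ] E n) := by
  ext1 x
  exact Submodule.starProjection_map_apply (Unitary.linearIsometryEquiv g) V.1 x

theorem continuous_rotate_left {n m : ℕ} (V : Gr n m) : Continuous fun g : O n => rotate g V := by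
  refine continuous_induced_rng.2 ?_
  have : ((fun V : Gr n m => V.1.starProjection) ∘ fun g : O n => rotate g V) = fun g : O n =>
      (g : E n →L[ℝ] E n) * V.1.starProjection * star (g : E n →L[ℝ] E n) :=
    funext fun g => starProjection_rotate g V
  rw [this]
  fun_prop

theorem continuous_rotate_right {n m : ℕ} (g : O n) :
    Continuous fun V : Gr n m => rotate g V := by
  refine continuous_induced_rng.2 ?_
  have : ((fun V : Gr n m => V.1.starProjection) ∘ fun V : Gr n m => rotate g V) =
      fun V : Gr n m =>
        (g : E n →L[ℝ] E n) * V.1.starProjection * star (g : E n →L[ℝ] E n) :=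
    funext fun V => starProjection_rotate g V
  rw [this]
  have h : Continuous fun V : Gr n m => V.1.starProjection := continuous_induced_dom
  exact (continuous_const.mul h).mul continuous_const

/-- `grMeasure` is a probability measure. -/
instance instIsProbabilityMeasureGr {n m : ℕ} (h : m ≤ n) :
    IsProbabilityMeasure (grMeasure h) := by
  have : IsProbabilityMeasure
      (Measure.haarMeasure (⊤ : TopologicalSpace.PositiveCompacts (O n))) :=
    ⟨by simpa using
      Measure.haarMeasure_self (K₀ := (⊤ : TopologicalSpace.PositiveCompacts (O n)))⟩
  exact Measure.isProbabilityMeasure_map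
    (continuous_rotate_left (coordSubspace h)).measurable.aemeasurable

/-- `grMeasure` is invariant under the action of `O(n)`. -/
theorem map_rotate_grMeasure {n m : ℕ} (h : m ≤ n) (g : O n) :
    (grMeasure h).map (rotate g) = grMeasure h := by
  have hl := (continuous_rotate_left (n := n) (coordSubspace h)).measurable
  have hmul : ∀ k : O n,
      rotate g (rotate k (coordSubspace h)) = rotate (g * k) (coordSubspace h) := by
    intro k
    refine Subtype.ext ?_
    simp only [rotate, ← Submodule.map_comp]
    rfl
  unfold grMeasure
  rw [Measure.map_map (continuous_rotate_right g).measurable hl]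
  conv_rhs => rw [← map_mul_left_eq_self
    (Measure.haarMeasure (⊤ : TopologicalSpace.PositiveCompacts (O n))) g]
  rw [Measure.map_map hl (measurable_const_mul g)]
  congr 1
  funext k
  exact hmul k

/-- `π_V F`, the image of `F` under orthogonal projection onto `V`, as a subset of `ℝⁿ`. -/
def proj {n m : ℕ} (V : Gr n m) (F : Set (E n)) : Set (E n) := V.1.starProjection '' F

end ProjDim

end

/-!
For a finite set of points of `F` separated at scale `δ`, the Cauchy-Schwarz inequality bounds the
covering number of its projection from below by means of the number of pairs of points whose
projections are `δ`-close. By Fubini's theorem in the unit ball, a random `m`-plane brings two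
points at distance `d` within `δ` of each other with probability `O((δ / d) ^ m)`. Summing over
dyadic distances, where the Assouad spectrum for `θ` close to `1` controls the number of points in
each ball, the expected number of close pairs per point is at most
`δ ^ (-(max 0 (dim_qA F - m) + o(1)))`. Markov's inequality and the Borel-Cantelli lemma along
`δ = 2 ^ (-k)` then bound the loss of box dimension almost surely.

For packing dimension, an analytic set of packing dimension greater than `t` contains a continuous
image of a Polish space all of whose non-empty open subsets have image of packing dimension greater
than `t`. The box dimension bound holds almost surely for a countable basis at once, and by the
Baire category theorem every countable cover of the projection by compact sets contains one
covering the projection of a non-empty open piece.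
-/

namespace ProjDim

variable {X Y : Type*}

/-! ### Covering numbers -/

section CoveringNumbers

variable [PseudoEMetricSpace X] [PseudoEMetricSpace Y] {r s : ℝ} {A B : Set X}

theorem coverNum_le_card (C : Finset (Set X)) (hA : A ⊆ ⋃ U ∈ C, U)
    (hC : ∀ U ∈ C, Metric.ediam U ≤ ENNReal.ofReal r) : coverNum r A ≤ C.card :=
  iInf_le_of_le C (iInf₂_le_of_le hA hC le_rfl)

theorem exists_cover_card_eq (h : coverNum r A ≠ ⊤) :
    ∃ C : Finset (Set X), A ⊆ ⋃ U ∈ C, U ∧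
      (∀ U ∈ C, Metric.ediam U ≤ ENNReal.ofReal r) ∧ coverNum r A = C.card := by
  obtain ⟨C, hC⟩ := ENat.exists_eq_iInf fun C : Finset (Set X) =>
    ⨅ (_ : A ⊆ ⋃ U ∈ C, U) (_ : ∀ U ∈ C, Metric.ediam U ≤ ENNReal.ofReal r), (C.card : ℕ∞)
  change _ = coverNum r A at hC
  rw [← hC] at h ⊢
  obtain ⟨hA, hd⟩ : A ⊆ ⋃ U ∈ C, U ∧ ∀ U ∈ C, Metric.ediam U ≤ ENNReal.ofReal r := by
    by_contra! hn
    refine h (iInf₂_eq_top.2 fun hA hd => ?_)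
    obtain ⟨U, hU, hU'⟩ := hn hA
    exact absurd (hd U hU) hU'.not_ge
  exact ⟨C, hA, hd, by rw [iInf_pos hA, iInf_pos hd]⟩

@[gcongr]
theorem coverNum_mono (h : A ⊆ B) : coverNum r A ≤ coverNum r B :=
  le_iInf fun C => le_iInf₂ fun hB hC => coverNum_le_card C (h.trans hB) hC

theorem coverNum_anti (h : r ≤ s) (A : Set X) : coverNum s A ≤ coverNum r A :=
  le_iInf fun C => le_iInf₂ fun hA hC =>
    coverNum_le_card C hA fun U hU => (hC U hU).trans (ENNReal.ofReal_le_ofReal h)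

theorem coverNum_image_le {f : X → Y} (hf : LipschitzWith 1 f) (r : ℝ) (A : Set X) :
    coverNum r (f '' A) ≤ coverNum r A := by
  classical
  refine le_iInf fun C => le_iInf₂ fun hA hC => ?_
  refine (coverNum_le_card (C.image (image f)) ?_ ?_).trans (by exact_mod_cast Finset.card_image_le)
  · rintro _ ⟨x, hx, rfl⟩
    obtain ⟨U, hU, hxU⟩ := mem_iUnion₂.1 (hA hx)
    exact mem_iUnion₂.2 ⟨f '' U, Finset.mem_image_of_mem _ hU, mem_image_of_mem f hxU⟩
  · simp only [Finset.forall_mem_image]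
    intro U hU
    simpa only [ENNReal.coe_one, one_mul] using (hf.ediam_image_le U).trans (by simpa using hC U hU)

theorem coverNum_closure (r : ℝ) (A : Set X) : coverNum r (closure A) = coverNum r A := by
  classical
  refine (coverNum_mono subset_closure).antisymm' (le_iInf fun C => le_iInf₂ fun hA hC => ?_)
  refine (coverNum_le_card (C.image closure) ?_ ?_).trans
    (by exact_mod_cast Finset.card_image_le)
  · refine (closure_mono hA).trans ?_
    rw [Finset.closure_biUnion]
    simp only [Finset.mem_image, iUnion_exists, biUnion_and', iUnion_iUnion_eq_right, subset_rfl]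
  · simp only [Finset.forall_mem_image, Metric.ediam_closure]
    exact hC

theorem coverNum_union_le (r : ℝ) (A B : Set X) :
    coverNum r (A ∪ B) ≤ coverNum r A + coverNum r B := by
  classical
  by_cases hA : coverNum r A = ⊤
  · simp only [hA, top_add, le_top]
  by_cases hB : coverNum r B = ⊤
  · simp only [hB, add_top, le_top]
  obtain ⟨C, hAC, hC, hcC⟩ := exists_cover_card_eq hA
  obtain ⟨D, hBD, hD, hcD⟩ := exists_cover_card_eq hB
  refine (coverNum_le_card (C ∪ D) ?_ fun U hU => ?_).trans (b := ((C ∪ D).card : ℕ∞)) ?_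
  · rw [Finset.set_biUnion_union]
    exact union_subset_union hAC hBD
  · exact (Finset.mem_union.1 hU).elim (hC U) (hD U)
  · rw [hcC, hcD]
    exact_mod_cast Finset.card_union_le C D

theorem coverNum_empty (r : ℝ) : coverNum r (∅ : Set X) = 0 :=
  nonpos_iff_eq_zero.1 (by simpa using coverNum_le_card (r := r) (A := (∅ : Set X)) ∅)

theorem coverNum_biUnion_le {ι : Type*} (r : ℝ) (T : Finset ι) (A : ι → Set X) :
    coverNum r (⋃ i ∈ T, A i) ≤ ∑ i ∈ T, coverNum r (A i) := by
  classical
  induction T using Finset.induction_on with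
  | empty => simp [coverNum_empty]
  | insert i T hi ih =>
    rw [Finset.set_biUnion_insert, Finset.sum_insert hi]
    exact (coverNum_union_le r _ _).trans (by gcongr)

theorem card_le_coverNum {P : Finset X} (hPA : ↑P ⊆ A)
    (hP : Metric.IsSeparated (ENNReal.ofReal r) (P : Set X)) : (P.card : ℕ∞) ≤ coverNum r A := by
  refine le_iInf fun C => le_iInf₂ fun hA hC => ?_
  have h : ∀ x ∈ P, ∃ U ∈ C, x ∈ U := fun x hx => by simpa using hA (hPA hx)
  choose! U hUC hU using h
  suffices P.card ≤ C.card by exact_mod_cast this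
  refine Finset.card_le_card_of_injOn U hUC fun x hx y hy hxy => ?_
  by_contra hne
  exact ((Metric.edist_le_ediam_of_mem (hU x hx) (hxy ▸ hU y hy)).trans (hC _ (hUC x hx))).not_gt
    (hP hx hy hne)

theorem coverNum_two_mul_le_card {P : Finset X} (h : Metric.IsCover r.toNNReal A (P : Set X)) :
    coverNum (2 * r) A ≤ P.card := by
  classical
  refine (coverNum_le_card (P.image fun y => Metric.closedEBall y (ENNReal.ofReal r)) ?_ ?_).trans
    (by exact_mod_cast Finset.card_image_le)
  · simpa [ENNReal.ofReal] using Metric.isCover_iff_subset_iUnion_closedEBall.1 h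
  · simp only [Finset.forall_mem_image]
    intro y _
    rw [ENNReal.ofReal_mul zero_le_two, ENNReal.ofReal_ofNat]
    exact Metric.ediam_closedEBall_le

theorem exists_isSeparated_coverNum_le_card (hA : TotallyBounded A) (hr : 0 < r) :
    ∃ P : Finset X, ↑P ⊆ A ∧ Metric.IsSeparated (ENNReal.ofReal r) (P : Set X) ∧
      coverNum (2 * r) A ≤ P.card := by
  have hfin : Metric.packingNumber r.toNNReal A ≠ ⊤ := by
    obtain ⟨N, -, hN, hc⟩ := Metric.exists_finite_isCover_of_totallyBounded
      (ε := r.toNNReal / 2) (half_pos (Real.toNNReal_pos.2 hr)).ne' hA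
    have h := (Metric.packingNumber_two_mul_le_externalCoveringNumber (r.toNNReal / 2) A).trans
      hc.externalCoveringNumber_le_encard
    rw [mul_div_cancel₀ _ two_ne_zero] at h
    exact (h.trans_lt hN.encard_lt_top).ne
  have hF : (Metric.maximalSeparatedSet r.toNNReal A).Finite := by
    rwa [← Set.encard_ne_top_iff, Metric.encard_maximalSeparatedSet hfin]
  refine ⟨hF.toFinset, ?_, ?_, coverNum_two_mul_le_card ?_⟩ <;> rw [hF.coe_toFinset]
  · exact Metric.maximalSeparatedSet_subset
  · exact Metric.isSeparated_maximalSeparatedSet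
  · exact Metric.isCover_maximalSeparatedSet hfin

end CoveringNumbers

/-! ### Box dimensions -/

section BoxDimension

theorem log_div_neg_log_le_add {r η : ℝ} (hr0 : 0 < r) (hr1 : r < 1) {x y : ℝ≥0∞}
    (h : x ≤ y * ENNReal.ofReal (r ^ (-η))) :
    ENNReal.log x / ((-Real.log r : ℝ) : EReal) ≤
      ENNReal.log y / ((-Real.log r : ℝ) : EReal) + η := by
  have hl : 0 < -Real.log r := neg_pos.2 (Real.log_neg hr0 hr1)
  have hl' : (0 : EReal) ≤ ((-Real.log r : ℝ) : EReal) := by exact_mod_cast hl.le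
  refine (EReal.div_le_div_right_of_nonneg hl' (ENNReal.log_le_log h)).trans_eq ?_
  rw [ENNReal.log_mul_add, ENNReal.log_ofReal_of_pos (Real.rpow_pos_of_pos hr0 _),
    Real.log_rpow hr0, EReal.add_div_of_nonneg_right hl', ← EReal.coe_div,
    neg_mul_comm, mul_div_cancel_right₀ _ hl.ne']

variable [PseudoEMetricSpace X] [PseudoEMetricSpace Y] {A : Set X} {B : Set Y} {η : ℝ}

theorem eventually_boxRatio_le_add (h : ∀ᶠ r in 𝓝[>] (0 : ℝ),
      (coverNum r A : ℝ≥0∞) ≤ coverNum r B * ENNReal.ofReal (r ^ (-η))) :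
    ∀ᶠ r in 𝓝[>] (0 : ℝ), boxRatio A r ≤ boxRatio B r + η := by
  filter_upwards [h, Ioo_mem_nhdsGT zero_lt_one] with r hr hr'
  exact log_div_neg_log_le_add hr'.1 hr'.2 hr

theorem upperBoxDim_le_add (h : ∀ᶠ r in 𝓝[>] (0 : ℝ),
      (coverNum r A : ℝ≥0∞) ≤ coverNum r B * ENNReal.ofReal (r ^ (-η))) :
    upperBoxDim A ≤ upperBoxDim B + η := by
  refine (limsup_le_limsup (eventually_boxRatio_le_add h)).trans
    ((EReal.limsup_add_le (v := fun _ => (η : EReal)) ?_ ?_).trans_eq ?_) <;> simp [upperBoxDim]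

theorem lowerBoxDim_le_add (h : ∀ᶠ r in 𝓝[>] (0 : ℝ),
      (coverNum r A : ℝ≥0∞) ≤ coverNum r B * ENNReal.ofReal (r ^ (-η))) :
    lowerBoxDim A ≤ lowerBoxDim B + η := by
  simp only [add_comm (lowerBoxDim B)]
  refine (liminf_le_liminf ((eventually_boxRatio_le_add h).mono fun r hr =>
    hr.trans_eq (add_comm _ _))).trans
    ((EReal.liminf_add_le (u := fun _ => (η : EReal)) ?_ ?_).trans_eq ?_) <;> simp [lowerBoxDim]

theorem upperBoxDim_le_of_coverNum_le (h : ∀ r, coverNum r A ≤ coverNum r B) :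
    upperBoxDim A ≤ upperBoxDim B := by
  simpa using upperBoxDim_le_add (η := 0) (.of_forall fun r => by simpa using h r)

theorem upperBoxDim_mono {A B : Set X} (h : A ⊆ B) : upperBoxDim A ≤ upperBoxDim B :=
  upperBoxDim_le_of_coverNum_le fun _ => coverNum_mono h

theorem upperBoxDim_closure (A : Set X) : upperBoxDim (closure A) = upperBoxDim A :=
  (upperBoxDim_mono subset_closure).antisymm'
    (upperBoxDim_le_of_coverNum_le fun r => (coverNum_closure r A).le)

theorem upperBoxDim_image_le {f : X → Y} (hf : LipschitzWith 1 f) (A : Set X) :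
    upperBoxDim (f '' A) ≤ upperBoxDim A :=
  upperBoxDim_le_of_coverNum_le fun r => coverNum_image_le hf r A

theorem lowerBoxDim_image_le {f : X → Y} (hf : LipschitzWith 1 f) (A : Set X) :
    lowerBoxDim (f '' A) ≤ lowerBoxDim A := by
  simpa using lowerBoxDim_le_add (η := 0)
    (.of_forall fun r => by simpa using coverNum_image_le hf r A)

theorem lowerBoxDim_le_upperBoxDim (A : Set X) : lowerBoxDim A ≤ upperBoxDim A :=
  liminf_le_limsup

theorem upperBoxDim_le_of_coverNum_le_mul_rpow {K s : ℝ} (h : ∀ᶠ r in 𝓝[>] (0 : ℝ),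
      (coverNum r A : ℝ≥0∞) ≤ ENNReal.ofReal (K * r ^ (-s))) : upperBoxDim A ≤ s := by
  refine EReal.le_of_forall_lt_iff_le.1 fun η hη => limsup_le_of_le (h := ?_)
  have hη : s < η := by exact_mod_cast hη
  have hlim : Tendsto (fun r : ℝ => K * r ^ (η - s)) (𝓝[>] 0) (𝓝 0) := by
    have h := (Real.continuousAt_rpow_const 0 (η - s) (.inr (sub_pos.2 hη).le)).const_mul K
    rw [ContinuousAt, Real.zero_rpow (sub_pos.2 hη).ne', mul_zero] at h
    exact h.mono_left nhdsWithin_le_nhds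
  filter_upwards [h, Ioo_mem_nhdsGT zero_lt_one, hlim.eventually (eventually_le_nhds one_pos)]
    with r hr ⟨hr0, hr1⟩ hr2
  have key : K * r ^ (-s) ≤ r ^ (-η) := calc
    K * r ^ (-s) = K * r ^ (η - s) * r ^ (-η) := by
      rw [mul_assoc, ← Real.rpow_add hr0, sub_add_eq_add_sub, add_neg_cancel, zero_sub]
    _ ≤ r ^ (-η) := mul_le_of_le_one_left (Real.rpow_pos_of_pos hr0 _).le hr2
  simpa [boxRatio] using log_div_neg_log_le_add (y := 1) hr0 hr1
    ((hr.trans (ENNReal.ofReal_le_ofReal key)).trans_eq (one_mul _).symm)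

theorem upperBoxDim_empty : upperBoxDim (∅ : Set X) = ⊥ :=
  (EReal.eq_bot_iff_forall_lt _).2 fun s => by
    refine (upperBoxDim_le_of_coverNum_le_mul_rpow (K := 0) (s := s - 1) ?_).trans_lt
      (by exact_mod_cast sub_one_lt s)
    simp [coverNum_empty]

end BoxDimension

section FiniteDimensional

variable {W : Type*} [NormedAddCommGroup W] [NormedSpace ℝ W] [FiniteDimensional ℝ W]

theorem card_mul_pow_le_of_isSeparated (P : Finset W) {D ρ : ℝ} (hρ : 0 < ρ) (hD : 0 ≤ D)
    (hPD : ∀ x ∈ P, ‖x‖ ≤ D) (hP : Metric.IsSeparated (ENNReal.ofReal ρ) (P : Set W)) :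
    (P.card : ℝ) * (ρ / 2) ^ Module.finrank ℝ W ≤ (ρ / 2 + D) ^ Module.finrank ℝ W := by
  borelize W
  let μ : Measure W := Measure.addHaar
  have hdisj : (P : Set W).PairwiseDisjoint fun c => Metric.ball c (ρ / 2) := fun c hc d hd hcd =>
    Metric.ball_disjoint_ball (by
      rw [add_halves]
      exact ((ENNReal.ofReal_lt_ofReal_iff' (p := ρ)).1 (edist_dist c d ▸ hP hc hd hcd)).1.le)
  have hsub : (⋃ c ∈ P, Metric.ball c (ρ / 2)) ⊆ Metric.ball (0 : W) (ρ / 2 + D) :=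
    iUnion₂_subset fun x hx => Metric.ball_subset_ball' (by
      rw [dist_zero_right]; gcongr; exact hPD x hx)
  have hμ := measure_mono (μ := μ) hsub
  rw [measure_biUnion_finset hdisj fun c _ => measurableSet_ball] at hμ
  simp only [μ.addHaar_ball_of_pos _ (half_pos hρ), Finset.sum_const, nsmul_eq_mul, ← mul_assoc,
    μ.addHaar_ball_of_pos _ (by positivity : 0 < ρ / 2 + D)] at hμ
  have hcard := ENNReal.toReal_le_of_le_ofReal (by positivity) <|
    (ENNReal.mul_le_mul_iff_left (Metric.measure_ball_pos _ _ zero_lt_one).ne'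
      measure_ball_lt_top.ne).1 hμ
  rwa [ENNReal.toReal_mul, ENNReal.toReal_ofReal (by positivity), ENNReal.toReal_natCast] at hcard

theorem upperBoxDim_le_finrank {A : Set W} (hA : Bornology.IsBounded A) :
    upperBoxDim A ≤ Module.finrank ℝ W := by
  have : ProperSpace W := FiniteDimensional.proper ℝ W
  set d := Module.finrank ℝ W
  obtain ⟨D, hD0, hD⟩ := hA.exists_pos_norm_le
  rw [← EReal.coe_coe_eq_natCast]
  refine upperBoxDim_le_of_coverNum_le_mul_rpow (K := (2 + 4 * D) ^ d) ?_
  filter_upwards [Ioo_mem_nhdsGT zero_lt_one] with r ⟨hr0, hr1⟩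
  obtain ⟨P, hPA, hP, hcov⟩ := exists_isSeparated_coverNum_le_card
    (hA.isCompact_closure.totallyBounded.subset subset_closure) (half_pos hr0)
  rw [mul_div_cancel₀ _ two_ne_zero] at hcov
  have hcard : (P.card : ℝ) ≤ (2 + 4 * D) ^ d * r ^ (-(d : ℝ)) := by
    have h := card_mul_pow_le_of_isSeparated P (half_pos hr0) hD0.le (fun x hx => hD x (hPA hx)) hP
    rw [← le_div_iff₀ (by positivity), ← div_pow] at h
    rw [Real.rpow_neg hr0.le, Real.rpow_natCast, ← div_eq_mul_inv, ← div_pow]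
    refine h.trans (pow_le_pow_left₀ (by positivity) ?_ _)
    rw [div_le_div_iff₀ (by positivity) hr0]
    nlinarith [mul_pos hr0 hD0]
  calc (coverNum r A : ℝ≥0∞) ≤ ((P.card : ℕ∞) : ℝ≥0∞) := by exact_mod_cast hcov
    _ = ENNReal.ofReal P.card := by simp
    _ ≤ _ := ENNReal.ofReal_le_ofReal hcard

end FiniteDimensional

/-! ### The upper Assouad spectrum and the quasi-Assouad dimension -/

section AssouadSpectrum

variable [PseudoMetricSpace X] {F A B : Set X} {θ α α' : ℝ}

theorem IsSpectrumExponent.mono (h : IsSpectrumExponent θ F α) (hα : α ≤ α') :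
    IsSpectrumExponent θ F α' := by
  obtain ⟨C, hC, H⟩ := h
  refine ⟨C, hC, fun r R hr hrR hRR hR1 x hx => (H r R hr hrR hRR hR1 x hx).trans ?_⟩
  gcongr
  exact (one_le_div hr).2 (hrR.trans hRR.le)

theorem isSpectrumExponent_of_quasiAssouadDim_lt (hα : quasiAssouadDim F < α) (hθ0 : 0 < θ)
    (hθ1 : θ < 1) : IsSpectrumExponent θ F α := by
  have hle : upperAssouadSpectrum θ F ≤ quasiAssouadDim F := by
    refine ge_of_tendsto (tendsto_quasiAssouadDim F) ?_
    filter_upwards [Ioo_mem_nhdsLT hθ1] with θ' hθ'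
    exact upperAssouadSpectrum_mono F hθ0 hθ'.1.le hθ'.2
  obtain ⟨α', hα', hlt⟩ : ∃ α', ∃ _ : IsSpectrumExponent θ F α', (α' : EReal) < α := by
    simpa only [upperAssouadSpectrum, iInf_lt_iff] using hle.trans_lt hα
  exact hα'.mono (by exact_mod_cast hlt.le)

theorem quasiAssouadDim_mono (h : A ⊆ B) : quasiAssouadDim A ≤ quasiAssouadDim B := by
  refine limsup_le_limsup (.of_forall fun θ => le_iInf₂ fun α hα => iInf₂_le α ?_)
  obtain ⟨C, hC, H⟩ := hα
  refine ⟨C, hC, fun r R hr hrR hRR hR1 x hx => le_trans ?_ (H r R hr hrR hRR hR1 x (h hx))⟩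
  gcongr

-- Radii `R < ρ ^ θ` are not controlled by the spectrum; replacing them by `ρ ^ θ` costs the factor
-- `ρ ^ (-((1 - θ) * α))`.
theorem IsSpectrumExponent.exists_coverNum_closedBall_inter_le (hθ0 : 0 < θ) (hθ1 : θ < 1)
    (hα : 0 ≤ α) (h : IsSpectrumExponent θ F α) :
    ∃ C, 0 < C ∧ ∀ ρ R, 0 < ρ → ρ ≤ R → R < 1 → ∀ x ∈ F,
      (coverNum ρ (Metric.closedBall x R ∩ F) : ℝ≥0∞) ≤
        ENNReal.ofReal (C * ρ ^ (-((1 - θ) * α)) * (R / ρ) ^ α) := by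
  obtain ⟨C, hC, H⟩ := h
  refine ⟨C, hC, fun ρ R hρ hρR hR1 x hx => ?_⟩
  have hρ1 : ρ < 1 := hρR.trans_lt hR1
  set S := max R (ρ ^ θ)
  have hS0 : 0 < S := (hρ.trans_le hρR).trans_le (le_max_left _ _)
  have hS1 : S < 1 := max_lt hR1 (Real.rpow_lt_one hρ.le hρ1 hθ0)
  have hρS : ρ ≤ S ^ (1 / θ) := by
    rw [one_div, Real.le_rpow_inv_iff_of_pos hρ.le hS0.le hθ0]
    exact le_max_right _ _
  have hSS : S ^ (1 / θ) < S := by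
    simpa using Real.rpow_lt_rpow_of_exponent_gt hS0 hS1 ((one_lt_div hθ0).2 hθ1)
  have hquot : S / ρ ≤ ρ ^ (-(1 - θ)) * (R / ρ) := by
    rw [← mul_div_assoc, div_le_div_iff_of_pos_right hρ, neg_sub]
    refine max_le (le_mul_of_one_le_left (hρ.le.trans hρR) ?_) ?_
    · exact Real.one_le_rpow_of_pos_of_le_one_of_nonpos hρ hρ1.le (by linarith)
    · rw [Real.rpow_sub_one hρ.ne', div_mul_eq_mul_div, le_div_iff₀ hρ]
      gcongr
  calc (coverNum ρ (Metric.closedBall x R ∩ F) : ℝ≥0∞)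
      ≤ coverNum ρ (Metric.closedBall x S ∩ F) := by gcongr; exact le_max_left _ _
    _ ≤ ENNReal.ofReal (C * (S / ρ) ^ α) := H ρ S hρ hρS hSS hS1 x hx
    _ ≤ ENNReal.ofReal (C * (ρ ^ (-(1 - θ)) * (R / ρ)) ^ α) := by gcongr
    _ = _ := by
      rw [Real.mul_rpow (by positivity) (div_nonneg (hρ.le.trans hρR) hρ.le),
        ← Real.rpow_mul hρ.le, neg_mul, mul_assoc]

theorem IsSpectrumExponent.exists_coverNum_closedBall_inter_le_of_totallyBounded
    (hF : TotallyBounded F) (hθ0 : 0 < θ) (hθ1 : θ < 1) (hα : 0 ≤ α)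
    (h : IsSpectrumExponent θ F α) :
    ∃ K, 0 < K ∧ ∀ ρ R, 0 < ρ → ρ ≤ 1 / 2 → ρ ≤ R → ∀ x ∈ F,
      (coverNum ρ (Metric.closedBall x R ∩ F) : ℝ≥0∞) ≤
        ENNReal.ofReal (K * ρ ^ (-((1 - θ) * α)) * (R / ρ) ^ α) := by
  obtain ⟨C, hC, hball⟩ := h.exists_coverNum_closedBall_inter_le hθ0 hθ1 hα
  obtain ⟨t, htF, htfin, ht⟩ := Metric.finite_approx_of_totallyBounded hF (1 / 2) one_half_pos
  lift t to Finset X using htfin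
  refine ⟨C * (t.card + 1), by positivity, fun ρ R hρ hρ2 hρR x hx => ?_⟩
  have hR0 : 0 < R := hρ.trans_le hρR
  rcases lt_or_ge R 1 with hR1 | hR1
  · refine (hball ρ R hρ hρR hR1 x hx).trans ?_
    gcongr
    exact le_mul_of_one_le_right hC.le (le_add_of_nonneg_left t.card.cast_nonneg)
  have hcover : Metric.closedBall x R ∩ F ⊆ ⋃ z ∈ t, Metric.closedBall z (1 / 2) ∩ F := by
    intro y hy
    obtain ⟨z, hz, hyz⟩ := mem_iUnion₂.1 (ht hy.2)
    exact mem_iUnion₂.2 ⟨z, hz, Metric.ball_subset_closedBall hyz, hy.2⟩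
  calc (coverNum ρ (Metric.closedBall x R ∩ F) : ℝ≥0∞)
      ≤ ∑ z ∈ t, (coverNum ρ (Metric.closedBall z (1 / 2) ∩ F) : ℝ≥0∞) := by
        refine (ENat.toENNReal_le.2
          ((coverNum_mono hcover).trans (coverNum_biUnion_le ρ t _))).trans_eq ?_
        exact map_sum ENat.toENNRealRingHom _ t
    _ ≤ ∑ _z ∈ t, ENNReal.ofReal (C * ρ ^ (-((1 - θ) * α)) * (R / ρ) ^ α) := by
        refine Finset.sum_le_sum fun z hz =>
          (hball ρ (1 / 2) hρ hρ2 one_half_lt_one z (htF hz)).trans ?_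
        gcongr
        linarith
    _ = ENNReal.ofReal (C * t.card * ρ ^ (-((1 - θ) * α)) * (R / ρ) ^ α) := by
        rw [Finset.sum_const, nsmul_eq_mul, ← ENNReal.ofReal_natCast,
          ← ENNReal.ofReal_mul t.card.cast_nonneg]
        ring_nf
    _ ≤ _ := by
        gcongr
        exact le_add_of_nonneg_right zero_le_one

theorem IsSpectrumExponent.exists_card_filter_dist_le (hF : TotallyBounded F) (hθ0 : 0 < θ)
    (hθ1 : θ < 1) (hα : 0 ≤ α) (h : IsSpectrumExponent θ F α) :
    ∃ K, 0 < K ∧ ∀ ρ R, 0 < ρ → ρ ≤ 1 / 2 → ρ ≤ R → ∀ P : Finset X, ↑P ⊆ F →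
      Metric.IsSeparated (ENNReal.ofReal ρ) (P : Set X) → ∀ x ∈ P,
        (({y ∈ P | dist y x ≤ R} : Finset X).card : ℝ) ≤
          K * ρ ^ (-((1 - θ) * α)) * (R / ρ) ^ α := by
  obtain ⟨K, hK, H⟩ :=
    h.exists_coverNum_closedBall_inter_le_of_totallyBounded hF hθ0 hθ1 hα
  refine ⟨K, hK, fun ρ R hρ hρ2 hρR P hPF hP x hx => ?_⟩
  have hball : (({y ∈ P | dist y x ≤ R} : Finset X) : Set X) ⊆ Metric.closedBall x R ∩ F :=
    fun y hy => ⟨(Finset.mem_filter.1 hy).2, hPF (Finset.mem_filter.1 hy).1⟩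
  have hcard := card_le_coverNum hball (hP.subset (Finset.coe_subset.2 (Finset.filter_subset _ _)))
  have hR0 : 0 < R := hρ.trans_le hρR
  simpa using ENNReal.toReal_le_of_le_ofReal (by positivity)
    ((ENat.toENNReal_le.2 hcard).trans (H ρ R hρ hρ2 hρR x (hPF hx)))

end AssouadSpectrum

/-! ### Counting pairs with close images -/

section ClosePairs

variable [PseudoMetricSpace Y]

open scoped Classical in
/-- The ordered pairs of points of `P`, diagonal included, whose images under `f` are at distance
at most `δ`. Their number is the discrete energy of the image of the counting measure on `P`. -/
noncomputable def closePairs (f : X → Y) (δ : ℝ) (P : Finset X) : Finset (X × X) :=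
  {p ∈ P ×ˢ P | dist (f p.1) (f p.2) ≤ δ}

theorem sq_card_le_card_mul_card_closePairs {f : X → Y} {δ : ℝ} (hδ : 0 ≤ δ) {P : Finset X}
    {C : Finset (Set Y)} (hPC : f '' P ⊆ ⋃ U ∈ C, U)
    (hC : ∀ U ∈ C, Metric.ediam U ≤ ENNReal.ofReal δ) :
    P.card ^ 2 ≤ C.card * (closePairs f δ P).card := by
  classical
  have h : ∀ x ∈ P, ∃ U ∈ C, f x ∈ U := fun x hx => by
    simpa using hPC (mem_image_of_mem f (Finset.mem_coe.2 hx))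
  choose! g hgC hg using h
  have hmaps : MapsTo (fun p => g p.1) (closePairs f δ P : Set (X × X)) C := fun p hp =>
    hgC _ (Finset.mem_product.1 (Finset.mem_filter.1 hp).1).1
  have hfiber : ∀ U ∈ C, ({x ∈ P | g x = U} : Finset X).card ^ 2 ≤
      ({p ∈ closePairs f δ P | g p.1 = U} : Finset (X × X)).card := by
    intro U hU
    rw [sq, ← Finset.card_product]
    refine Finset.card_le_card fun p hp => ?_
    simp only [Finset.mem_product, Finset.mem_filter, closePairs] at hp ⊢
    obtain ⟨⟨hp1, hU1⟩, hp2, hU2⟩ := hp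
    refine ⟨⟨⟨hp1, hp2⟩, ?_⟩, hU1⟩
    have hdiam := (Metric.edist_le_ediam_of_mem (hU1 ▸ hg _ hp1) (hU2 ▸ hg _ hp2)).trans (hC U hU)
    rwa [edist_dist, ENNReal.ofReal_le_ofReal_iff hδ] at hdiam
  calc P.card ^ 2 = (∑ U ∈ C, ({x ∈ P | g x = U} : Finset X).card) ^ 2 := by
        rw [Finset.card_eq_sum_card_fiberwise hgC]
    _ ≤ C.card * ∑ U ∈ C, ({x ∈ P | g x = U} : Finset X).card ^ 2 := sq_sum_le_card_mul_sum_sq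
    _ ≤ C.card * ∑ U ∈ C, ({p ∈ closePairs f δ P | g p.1 = U} : Finset (X × X)).card := by
        gcongr with U hU
        exact hfiber U hU
    _ = C.card * (closePairs f δ P).card := by
        rw [Finset.card_eq_sum_card_fiberwise hmaps]

theorem sq_card_le_coverNum_mul_card_closePairs {f : X → Y} {A : Set X} {P : Finset X}
    (hP : ↑P ⊆ A) {δ : ℝ} (hδ : 0 ≤ δ) :
    (P.card : ℝ≥0∞) ^ 2 ≤ coverNum δ (f '' A) * ((closePairs f δ P).card : ℝ≥0∞) := by
  rcases P.eq_empty_or_nonempty with rfl | ⟨x, hx⟩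
  · simp
  by_cases htop : coverNum δ (f '' A) = ⊤
  · have hdiag : (closePairs f δ P).card ≠ 0 :=
      Finset.card_ne_zero_of_mem (a := (x, x)) (by simp [closePairs, hx, hδ])
    simp [htop, ENNReal.top_mul, hdiag]
  · obtain ⟨C, hAC, hC, hcard⟩ := exists_cover_card_eq htop
    rw [hcard]
    exact_mod_cast sq_card_le_card_mul_card_closePairs hδ ((image_mono hP).trans hAC) hC

variable {Ω : Type*} [MeasurableSpace Ω] {μ : Measure Ω} {f : Ω → X → Y} {P : Finset X} {b δ : ℝ}

theorem card_closePairs_eq_sum (f : X → Y) (δ : ℝ) (P : Finset X) :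
    ((closePairs f δ P).card : ℝ≥0∞) =
      ∑ x ∈ P, ∑ y ∈ P, {g : X → Y | dist (g x) (g y) ≤ δ}.indicator 1 f := by
  classical
  rw [closePairs, Finset.card_filter, ← Finset.sum_product', Nat.cast_sum]
  simp [indicator_apply]

theorem measurable_card_closePairs (hf : ∀ x y, Measurable fun ω => dist (f ω x) (f ω y)) :
    Measurable fun ω => ((closePairs (f ω) δ P).card : ℝ≥0∞) := by
  simp only [card_closePairs_eq_sum]
  exact Finset.measurable_fun_sum _ fun x _ => Finset.measurable_fun_sum _ fun y _ =>
    measurable_one.indicator (measurableSet_le (hf x y) measurable_const)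

theorem lintegral_card_closePairs_le [IsFiniteMeasure μ]
    (hf : ∀ x y, Measurable fun ω => dist (f ω x) (f ω y))
    (hb : ∀ x ∈ P, ∑ y ∈ P, μ.real {ω | dist (f ω x) (f ω y) ≤ δ} ≤ b) :
    ∫⁻ ω, (closePairs (f ω) δ P).card ∂μ ≤ P.card * ENNReal.ofReal b := by
  have hS : ∀ x y, MeasurableSet {ω | dist (f ω x) (f ω y) ≤ δ} := fun x y =>
    measurableSet_le (hf x y) measurable_const
  have hind : ∀ x y, Measurable fun ω =>
      {g : X → Y | dist (g x) (g y) ≤ δ}.indicator (1 : (X → Y) → ℝ≥0∞) (f ω) := fun x y =>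
    measurable_one.indicator (hS x y)
  calc ∫⁻ ω, (closePairs (f ω) δ P).card ∂μ
      = ∑ x ∈ P, ∑ y ∈ P, μ {ω | dist (f ω x) (f ω y) ≤ δ} := by
        simp only [card_closePairs_eq_sum]
        rw [lintegral_finsetSum _ fun x _ => Finset.measurable_fun_sum _ fun y _ => hind x y]
        refine Finset.sum_congr rfl fun x _ => ?_
        rw [lintegral_finsetSum _ fun y _ => hind x y]
        exact Finset.sum_congr rfl fun y _ => lintegral_indicator_one (hS x y)
    _ = ∑ x ∈ P, ENNReal.ofReal (∑ y ∈ P, μ.real {ω | dist (f ω x) (f ω y) ≤ δ}) := by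
        refine Finset.sum_congr rfl fun x _ => ?_
        rw [ENNReal.ofReal_sum_of_nonneg fun _ _ => measureReal_nonneg]
        exact Finset.sum_congr rfl fun y _ => (ofReal_measureReal (μ := μ)).symm
    _ ≤ ∑ _x ∈ P, ENNReal.ofReal b :=
        Finset.sum_le_sum fun x hx => ENNReal.ofReal_le_ofReal (hb x hx)
    _ = P.card * ENNReal.ofReal b := by rw [Finset.sum_const, nsmul_eq_mul]

theorem measure_coverNum_mul_lt_card_le [IsFiniteMeasure μ] {A : Set X} (hPA : ↑P ⊆ A)
    (hδ : 0 ≤ δ) (hf : ∀ x y, Measurable fun ω => dist (f ω x) (f ω y))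
    (hb : ∀ x ∈ P, ∑ y ∈ P, μ.real {ω | dist (f ω x) (f ω y) ≤ δ} ≤ b) {t : ℝ} (ht : 0 < t) :
    μ {ω | coverNum δ (f ω '' A) * ENNReal.ofReal t < P.card} ≤ ENNReal.ofReal (b / t) := by
  rcases P.eq_empty_or_nonempty with rfl | hP
  · simp
  have hN0 : (P.card : ℝ≥0∞) ≠ 0 := by exact_mod_cast hP.card_ne_zero
  have hN : (P.card : ℝ≥0∞) ≠ ⊤ := ENNReal.natCast_ne_top _
  have ht' : ENNReal.ofReal t ≠ 0 := (ENNReal.ofReal_pos.2 ht).ne'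
  have hsub : {ω | coverNum δ (f ω '' A) * ENNReal.ofReal t < P.card} ⊆
      {ω | P.card * ENNReal.ofReal t ≤ ((closePairs (f ω) δ P).card : ℝ≥0∞)} := by
    intro ω hω
    refine (ENNReal.mul_le_mul_iff_right hN0 hN).1 ?_
    calc P.card * (P.card * ENNReal.ofReal t) = (P.card : ℝ≥0∞) ^ 2 * ENNReal.ofReal t := by ring
      _ ≤ coverNum δ (f ω '' A) * (closePairs (f ω) δ P).card * ENNReal.ofReal t := by
          gcongr
          exact sq_card_le_coverNum_mul_card_closePairs hPA hδ
      _ = coverNum δ (f ω '' A) * ENNReal.ofReal t * (closePairs (f ω) δ P).card := by ring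
      _ ≤ P.card * (closePairs (f ω) δ P).card := by gcongr; exact le_of_lt hω
  calc μ {ω | coverNum δ (f ω '' A) * ENNReal.ofReal t < P.card}
      ≤ μ {ω | P.card * ENNReal.ofReal t ≤ ((closePairs (f ω) δ P).card : ℝ≥0∞)} :=
        measure_mono hsub
    _ ≤ (∫⁻ ω, (closePairs (f ω) δ P).card ∂μ) / (P.card * ENNReal.ofReal t) :=
        meas_ge_le_lintegral_div (measurable_card_closePairs hf).aemeasurable
          (mul_ne_zero hN0 ht') (ENNReal.mul_ne_top hN ENNReal.ofReal_ne_top)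
    _ ≤ P.card * ENNReal.ofReal b / (P.card * ENNReal.ofReal t) := by
        gcongr
        exact lintegral_card_closePairs_le hf hb
    _ = ENNReal.ofReal (b / t) := by
        rw [ENNReal.mul_div_mul_left _ _ hN0 hN, ENNReal.ofReal_div_of_pos ht]

end ClosePairs

/-! ### Covering numbers of images under a transversal family -/

section DyadicSum

variable {a c s t δ α : ℝ}

theorem exists_le_mul_two_pow_rpow (hδ : 0 < δ) (hc : 0 ≤ c) (hs : 0 ≤ s) (ha : a ≤ c)
    (hat : 0 < t → a ≤ c * (δ / t) ^ s) {M : ℕ} (ht : t ≤ 2 ^ M * δ) :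
    ∃ j < M + 2, t ≤ 2 ^ j * δ ∧ a ≤ c * 2 ^ s * ((2 : ℝ) ^ j) ^ (-s) := by
  rcases le_or_gt t δ with htδ | htδ
  · refine ⟨0, by lia, by simpa using htδ, ?_⟩
    simpa using ha.trans (le_mul_of_one_le_right hc (Real.one_le_rpow one_le_two hs))
  · have ht0 : 0 < t := hδ.trans htδ
    obtain ⟨j, hj, hj'⟩ := exists_nat_pow_near ((one_le_div hδ).2 htδ.le) (one_lt_two (α := ℝ))
    rw [le_div_iff₀ hδ] at hj
    rw [div_lt_iff₀ hδ] at hj'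
    have hjM : (2 : ℝ) ^ j ≤ 2 ^ M := le_of_mul_le_mul_right (hj.trans ht) hδ
    have hjM : j ≤ M := (pow_le_pow_iff_right₀ one_lt_two).1 hjM
    refine ⟨j + 1, by lia, hj'.le, (hat ht0).trans ?_⟩
    calc c * (δ / t) ^ s ≤ c * ((2 : ℝ) ^ j)⁻¹ ^ s := by
          gcongr
          rwa [div_le_iff₀ ht0, inv_mul_eq_div, le_div_iff₀ (by positivity), mul_comm]
      _ = c * 2 ^ s * ((2 : ℝ) ^ (j + 1)) ^ (-s) := by
          rw [Real.rpow_neg (by positivity), ← Real.inv_rpow (by positivity), mul_assoc,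
            ← Real.mul_rpow zero_le_two (by positivity), pow_succ, mul_inv_rev,
            mul_inv_cancel_left₀ two_ne_zero]

theorem sum_le_of_card_filter_le {ι : Type*} {P : Finset ι} {a t : ι → ℝ} (hδ : 0 < δ) (hc : 0 ≤ c)
    (hs : 0 ≤ s) (ha : ∀ i ∈ P, a i ≤ c) (hat : ∀ i ∈ P, 0 < t i → a i ≤ c * (δ / t i) ^ s) {M : ℕ}
    (ht : ∀ i ∈ P, t i ≤ 2 ^ M * δ) {B : ℝ} (hB : 0 ≤ B)
    (hcard : ∀ j, (({i ∈ P | t i ≤ 2 ^ j * δ} : Finset ι).card : ℝ) ≤ B * ((2 : ℝ) ^ j) ^ α) :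
    ∑ i ∈ P, a i ≤ c * 2 ^ s * ((M + 2) * (B * ((2 : ℝ) ^ (M + 1)) ^ max 0 (α - s))) := by
  have hterm : ∀ i ∈ P, a i ≤ c * 2 ^ s * ∑ j ∈ Finset.range (M + 2),
      ((2 : ℝ) ^ j) ^ (-s) * if t i ≤ 2 ^ j * δ then 1 else 0 := by
    intro i hi
    obtain ⟨j, hj, htj, haj⟩ := exists_le_mul_two_pow_rpow hδ hc hs (ha i hi) (hat i hi) (ht i hi)
    refine haj.trans (mul_le_mul_of_nonneg_left ?_ (by positivity))
    have hsingle := Finset.single_le_sum (f := fun j => ((2 : ℝ) ^ j) ^ (-s) *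
      if t i ≤ 2 ^ j * δ then 1 else 0) (fun j _ => by positivity) (Finset.mem_range.2 hj)
    simpa only [htj, if_true, mul_one] using hsingle
  have hscale : ∀ j ∈ Finset.range (M + 2), ((2 : ℝ) ^ j) ^ (-s) *
      (({i ∈ P | t i ≤ 2 ^ j * δ} : Finset ι).card : ℝ) ≤
        B * ((2 : ℝ) ^ (M + 1)) ^ max 0 (α - s) := by
    intro j hj
    calc _ ≤ ((2 : ℝ) ^ j) ^ (-s) * (B * ((2 : ℝ) ^ j) ^ α) := by gcongr; exact hcard j
      _ = B * ((2 : ℝ) ^ j) ^ (α - s) := by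
          rw [mul_left_comm, ← Real.rpow_add (by positivity), neg_add_eq_sub]
      _ ≤ B * ((2 : ℝ) ^ j) ^ max 0 (α - s) := by
          gcongr
          exacts [one_le_pow₀ one_le_two, le_max_right _ _]
      _ ≤ B * ((2 : ℝ) ^ (M + 1)) ^ max 0 (α - s) := by
          gcongr
          exacts [one_le_two, Nat.lt_succ_iff.1 (Finset.mem_range.1 hj)]
  calc ∑ i ∈ P, a i ≤ ∑ i ∈ P, c * 2 ^ s * ∑ j ∈ Finset.range (M + 2),
        ((2 : ℝ) ^ j) ^ (-s) * if t i ≤ 2 ^ j * δ then 1 else 0 := Finset.sum_le_sum hterm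
    _ = c * 2 ^ s * ∑ j ∈ Finset.range (M + 2), ((2 : ℝ) ^ j) ^ (-s) *
        (({i ∈ P | t i ≤ 2 ^ j * δ} : Finset ι).card : ℝ) := by
        rw [← Finset.mul_sum, Finset.sum_comm]
        simp only [← Finset.mul_sum, Finset.sum_boole]
    _ ≤ c * 2 ^ s * ∑ _j ∈ Finset.range (M + 2), B * ((2 : ℝ) ^ (M + 1)) ^ max 0 (α - s) :=
        mul_le_mul_of_nonneg_left (Finset.sum_le_sum hscale) (by positivity)
    _ = _ := by
        rw [Finset.sum_const, Finset.card_range, nsmul_eq_mul]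
        push_cast
        rfl

theorem summable_mul_half_pow_rpow (A B : ℝ) (hs : 0 < s) :
    Summable fun k : ℕ => A * (k + B) * ((1 / 2 : ℝ) ^ k) ^ s := by
  have hq : ‖(1 / 2 : ℝ) ^ s‖ < 1 := by
    rw [Real.norm_of_nonneg (by positivity)]
    exact Real.rpow_lt_one one_half_pos.le one_half_lt_one hs
  have hlin := summable_pow_mul_geometric_of_norm_lt_one 1 hq
  have hconst := (summable_geometric_of_norm_lt_one hq).mul_left B
  refine ((hlin.add hconst).mul_left A).congr fun k => ?_
  rw [Real.rpow_pow_comm one_half_pos.le]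
  ring

end DyadicSum

section Transversal

variable [PseudoMetricSpace X] [PseudoMetricSpace Y] {Ω : Type*} [MeasurableSpace Ω]
  {μ : Measure Ω} {f : Ω → X → Y} {F : Set X} {s η : ℝ}

/-- A random family of maps `f ω : X → Y` is transversal with exponent `s` if the probability that
two points at distance `d` have images at distance at most `δ` is `O((δ / d) ^ s)`. Orthogonal
projections onto random `m`-planes are transversal with exponent `m`, and this is the only property
of the Grassmannian that the lower bounds use. -/
structure IsTransversal (μ : Measure Ω) (f : Ω → X → Y) (s : ℝ) : Prop where
  measurable_dist : ∀ x y, Measurable fun ω => dist (f ω x) (f ω y)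
  exists_measureReal_le : ∃ c, ∀ x y, 0 < dist x y → ∀ δ, 0 < δ →
    μ.real {ω | dist (f ω x) (f ω y) ≤ δ} ≤ c * (δ / dist x y) ^ s

theorem IsTransversal.exists_sum_measureReal_le [IsFiniteMeasure μ] (hf : IsTransversal μ f s)
    (hs : 0 ≤ s) (hF : TotallyBounded F) {θ α : ℝ} (hθ0 : 0 < θ) (hθ1 : θ < 1) (hα : 0 ≤ α)
    (h : IsSpectrumExponent θ F α) :
    ∃ A L : ℝ, ∀ (k : ℕ) (P : Finset X), ↑P ⊆ F →
      Metric.IsSeparated (ENNReal.ofReal ((1 / 2) ^ k / 4)) (P : Set X) → ∀ x ∈ P,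
      ∑ y ∈ P, μ.real {ω | dist (f ω x) (f ω y) ≤ (1 / 2) ^ k} ≤
        A * (k + L) * ((1 / 2 : ℝ) ^ k) ^ (-((1 - θ) * α + max 0 (α - s))) := by
  obtain ⟨K, hK, hcount⟩ := h.exists_card_filter_dist_le hF hθ0 hθ1 hα
  obtain ⟨c, hc⟩ := hf.exists_measureReal_le
  obtain ⟨L, hL⟩ := pow_unbounded_of_one_lt (Metric.diam F) (one_lt_two (α := ℝ))
  set ε := (1 - θ) * α
  set β := max 0 (α - s)
  set c' := max c (μ.real univ)
  refine ⟨c' * 2 ^ s * (K * 4 ^ ε * 4 ^ α * ((2 : ℝ) ^ (L + 1)) ^ β), L + 2,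
    fun k P hPF hP x hx => ?_⟩
  set δ : ℝ := (1 / 2) ^ k
  have hδ0 : 0 < δ := by positivity
  have hδ1 : δ ≤ 1 := pow_le_one₀ one_half_pos.le one_half_lt_one.le
  have hkδ : (2 : ℝ) ^ k = δ⁻¹ := by simp [δ]
  have hc' : 0 ≤ c' := measureReal_nonneg.trans (le_max_right _ _)
  have hM : ∀ y ∈ P, dist y x ≤ 2 ^ (k + L) * δ := by
    intro y hy
    rw [pow_add, hkδ, mul_right_comm, inv_mul_cancel₀ hδ0.ne', one_mul]
    exact (Metric.dist_le_diam_of_mem hF.isBounded (hPF hy) (hPF hx)).trans hL.le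
  have hcard : ∀ j : ℕ, (({y ∈ P | dist y x ≤ 2 ^ j * δ} : Finset X).card : ℝ) ≤
      K * 4 ^ ε * 4 ^ α * δ ^ (-ε) * ((2 : ℝ) ^ j) ^ α := by
    intro j
    have h2j : (1 : ℝ) ≤ 2 ^ j := one_le_pow₀ one_le_two
    refine (hcount (δ / 4) (2 ^ j * δ) (by positivity) (by linarith) (by nlinarith) P hPF hP x
      hx).trans_eq ?_
    rw [Real.div_rpow hδ0.le (by norm_num), Real.rpow_neg (by norm_num : (0 : ℝ) ≤ 4),
      div_inv_eq_mul, mul_div_assoc, div_div_cancel₀ hδ0.ne',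
      Real.mul_rpow (by positivity) (by norm_num)]
    ring
  refine (sum_le_of_card_filter_le hδ0 hc' hs (fun y _ => ?_) (fun y _ hxy => ?_) hM
    (by positivity) hcard).trans_eq ?_
  · exact (measureReal_mono (subset_univ _)).trans (le_max_right _ _)
  · rw [dist_comm] at hxy ⊢
    refine (hc x y hxy δ hδ0).trans ?_
    gcongr
    exact le_max_left _ _
  · rw [add_assoc k, pow_add, hkδ, Real.mul_rpow (by positivity) (by positivity),
      Real.inv_rpow hδ0.le, ← Real.rpow_neg hδ0.le, neg_add, Real.rpow_add hδ0]
    push_cast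
    ring

theorem eventually_coverNum_le_of_half_pow {A : Set X} {B : Set Y} (hη : 0 ≤ η)
    (h : ∀ᶠ k : ℕ in atTop, (coverNum ((1 / 2) ^ (k + 1)) A : ℝ≥0∞) ≤
      coverNum ((1 / 2) ^ k) B * ENNReal.ofReal (((1 / 2 : ℝ) ^ k) ^ (-η))) :
    ∀ᶠ r in 𝓝[>] (0 : ℝ), (coverNum r A : ℝ≥0∞) ≤ coverNum r B * ENNReal.ofReal (r ^ (-η)) := by
  obtain ⟨k₀, hk₀⟩ := eventually_atTop.1 h
  filter_upwards [Ioo_mem_nhdsGT (show (0 : ℝ) < (1 / 2) ^ k₀ by positivity)] with r ⟨hr0, hr⟩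
  obtain ⟨k, hkr, hrk⟩ := exists_nat_pow_near_of_lt_one hr0
    (hr.le.trans (pow_le_one₀ one_half_pos.le one_half_lt_one.le)) one_half_pos one_half_lt_one
  have hk : k₀ ≤ k := Nat.lt_succ_iff.1 <|
    (pow_lt_pow_iff_right_of_lt_one₀ one_half_pos one_half_lt_one).1 (hkr.trans hr)
  calc (coverNum r A : ℝ≥0∞) ≤ coverNum ((1 / 2) ^ (k + 1)) A :=
        ENat.toENNReal_le.2 (coverNum_anti hkr.le A)
    _ ≤ coverNum ((1 / 2) ^ k) B * ENNReal.ofReal (((1 / 2 : ℝ) ^ k) ^ (-η)) := hk₀ k hk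
    _ ≤ coverNum r B * ENNReal.ofReal (r ^ (-η)) :=
        mul_le_mul' (ENat.toENNReal_le.2 (coverNum_anti hrk B)) <| ENNReal.ofReal_le_ofReal <|
          Real.rpow_le_rpow_of_nonpos hr0 hrk (neg_nonpos.2 hη)

theorem IsTransversal.ae_eventually_coverNum_le_of_isSpectrumExponent [IsFiniteMeasure μ]
    (hf : IsTransversal μ f s) (hs : 0 ≤ s) (hF : TotallyBounded F) {θ α : ℝ} (hθ0 : 0 < θ)
    (hθ1 : θ < 1) (hα : 0 ≤ α) (h : IsSpectrumExponent θ F α)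
    (hη : (1 - θ) * α + max 0 (α - s) < η) :
    ∀ᵐ ω ∂μ, ∀ᶠ r in 𝓝[>] (0 : ℝ),
      (coverNum r F : ℝ≥0∞) ≤ coverNum r (f ω '' F) * ENNReal.ofReal (r ^ (-η)) := by
  have hη0 : 0 ≤ η := le_trans
    (add_nonneg (mul_nonneg (sub_nonneg.2 hθ1.le) hα) (le_max_left _ _)) hη.le
  obtain ⟨A, L, hsum⟩ := hf.exists_sum_measureReal_le hs hF hθ0 hθ1 hα h
  choose P hPF hP hcov using fun k : ℕ => exists_isSeparated_coverNum_le_card hF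
    (r := (1 / 2) ^ k / 4) (by positivity)
  let bad : ℕ → Set Ω := fun k => {ω | coverNum ((1 / 2) ^ k) (f ω '' F) *
    ENNReal.ofReal (((1 / 2 : ℝ) ^ k) ^ (-η)) < (P k).card}
  have hbad : ∀ k, μ (bad k) ≤ ENNReal.ofReal (A * (k + L) *
      ((1 / 2 : ℝ) ^ k) ^ (η - ((1 - θ) * α + max 0 (α - s)))) := by
    intro k
    have hδ : (0 : ℝ) < (1 / 2) ^ k := by positivity
    refine (measure_coverNum_mul_lt_card_le (hPF k) hδ.le hf.measurable_dist
      (hsum k (P k) (hPF k) (hP k)) (by positivity)).trans_eq ?_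
    rw [mul_div_assoc, ← Real.rpow_sub hδ, sub_neg_eq_add, neg_add_eq_sub]
  have hfin : ∑' k, μ (bad k) ≠ ⊤ := ne_top_of_le_ne_top
    (summable_mul_half_pow_rpow A L (sub_pos.2 hη)).tsum_ofReal_ne_top (ENNReal.tsum_le_tsum hbad)
  filter_upwards [ae_eventually_notMem hfin] with ω hω
  refine eventually_coverNum_le_of_half_pow hη0 (hω.mono fun k hk => ?_)
  refine le_trans ?_ (not_lt.1 hk)
  have hscale : (2 : ℝ) * ((1 / 2) ^ k / 4) = (1 / 2) ^ (k + 1) := by ring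
  exact_mod_cast hscale ▸ hcov k

theorem IsTransversal.ae_eventually_coverNum_le [IsFiniteMeasure μ] (hf : IsTransversal μ f s)
    (hs : 0 ≤ s) (hF : TotallyBounded F) (hη : max 0 (quasiAssouadDim F - s) < η) :
    ∀ᵐ ω ∂μ, ∀ᶠ r in 𝓝[>] (0 : ℝ),
      (coverNum r F : ℝ≥0∞) ≤ coverNum r (f ω '' F) * ENNReal.ofReal (r ^ (-η)) := by
  obtain ⟨hη0, hη1⟩ := max_lt_iff.1 hη
  have hη0 : 0 < η := by exact_mod_cast hη0
  rw [EReal.sub_lt_iff (.inl (EReal.coe_ne_bot s)) (.inl (EReal.coe_ne_top s))] at hη1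
  obtain ⟨α₀, hα₀, hα₀η⟩ := EReal.lt_iff_exists_real_btwn.1 hη1
  have hα₀η : α₀ < η + s := by exact_mod_cast hα₀η
  set α := max 0 α₀
  have hα0 : 0 ≤ α := le_max_left _ _
  have hαη : α < η + s := max_lt (by positivity) hα₀η
  have hqα : quasiAssouadDim F < α := hα₀.trans_le (by exact_mod_cast le_max_right _ _)
  have hlim : ∀ᶠ θ in 𝓝[<] (1 : ℝ), (1 - θ) * α + max 0 (α - s) < η := by
    have hcont : ContinuousAt (fun θ : ℝ => (1 - θ) * α + max 0 (α - s)) 1 := by fun_prop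
    refine (hcont.eventually_lt continuousAt_const ?_).filter_mono nhdsWithin_le_nhds
    rw [sub_self, zero_mul, zero_add]
    exact max_lt hη0 (sub_lt_iff_lt_add.2 hαη)
  obtain ⟨θ, hθ, hθ0, hθ1⟩ := (hlim.and (Ioo_mem_nhdsLT zero_lt_one)).exists
  exact hf.ae_eventually_coverNum_le_of_isSpectrumExponent hs hF hθ0 hθ1 hα0
    (isSpectrumExponent_of_quasiAssouadDim_lt hqα hθ0 hθ1) hθ

end Transversal

/-! ### Lower bounds for the box dimensions of images -/

section SubLe

variable {a b c : EReal}

theorem sub_le_of_forall_rat_lt (h : ∀ q : ℚ, ((q : ℝ) : EReal) < a → ((q : ℝ) : EReal) - c ≤ b) :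
    a - c ≤ b := by
  rw [sub_eq_add_neg]
  refine EReal.add_le_of_forall_lt fun a' ha' d hd => ?_
  obtain ⟨q, haq, hqa⟩ := EReal.lt_iff_exists_rat_btwn.1 ha'
  exact (add_le_add haq.le hd.le).trans (h q hqa)

theorem sub_le_of_forall_rat_gt
    (h : ∀ q : ℚ, c < ((q : ℝ) : EReal) → a ≤ b + ((q : ℝ) : EReal)) : a - c ≤ b := by
  rw [sub_eq_add_neg]
  refine EReal.add_le_of_forall_lt fun a' ha' d hd => ?_
  obtain ⟨q, hcq, hqd⟩ := EReal.lt_iff_exists_rat_btwn.1 (EReal.lt_neg_comm.1 hd)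
  have hab : a' - ((q : ℝ) : EReal) ≤ b :=
    EReal.sub_le_of_le_add (ha'.le.trans (h q hcq))
  exact (add_le_add_right (EReal.le_neg_of_le_neg hqd.le) a').trans hab

theorem min_le_sub_max_sub {d q : EReal} {s : ℝ} (hd : d < ⊤) (hq : q ≤ max (s : EReal) d) :
    min (s : EReal) d ≤ d - max 0 (q - s) := by
  rcases le_or_gt q s with hqs | hsq
  · rw [max_eq_left (EReal.sub_nonpos.2 hqs), sub_zero]
    exact min_le_right _ _
  · have hqd : q ≤ d := (le_max_iff.1 hq).resolve_left hsq.not_ge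
    lift q to ℝ using ⟨(hqd.trans_lt hd).ne, (bot_le.trans_lt hsq).ne'⟩
    lift d to ℝ using ⟨hd.ne, ((EReal.bot_lt_coe q).trans_le hqd).ne'⟩
    norm_cast at hqd hsq ⊢
    rw [max_eq_right (by exact_mod_cast (sub_pos.2 hsq).le)]
    refine (min_le_left _ _).trans ?_
    exact_mod_cast (by linarith : s ≤ d - (q - s))

end SubLe

section BoxDimension

variable [PseudoMetricSpace X] [PseudoMetricSpace Y] {Ω : Type*} [MeasurableSpace Ω]
  {μ : Measure Ω} [IsFiniteMeasure μ] {f : Ω → X → Y} {F : Set X} {s : ℝ}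

theorem IsTransversal.ae_forall_rat_eventually_coverNum_le (hf : IsTransversal μ f s) (hs : 0 ≤ s)
    (hF : TotallyBounded F) :
    ∀ᵐ ω ∂μ, ∀ q : ℚ, max 0 (quasiAssouadDim F - s) < ((q : ℝ) : EReal) →
      ∀ᶠ r in 𝓝[>] (0 : ℝ),
        (coverNum r F : ℝ≥0∞) ≤ coverNum r (f ω '' F) * ENNReal.ofReal (r ^ (-(q : ℝ))) :=
  ae_all_iff.2 fun _ => eventually_imp_distrib_left.2 (hf.ae_eventually_coverNum_le hs hF)

theorem IsTransversal.ae_sub_le_upperBoxDim (hf : IsTransversal μ f s) (hs : 0 ≤ s)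
    (hF : TotallyBounded F) :
    ∀ᵐ ω ∂μ, upperBoxDim F - max 0 (quasiAssouadDim F - s) ≤ upperBoxDim (f ω '' F) := by
  filter_upwards [hf.ae_forall_rat_eventually_coverNum_le hs hF] with ω hω
  exact sub_le_of_forall_rat_gt fun q hq => upperBoxDim_le_add (hω q hq)

theorem IsTransversal.ae_sub_le_lowerBoxDim (hf : IsTransversal μ f s) (hs : 0 ≤ s)
    (hF : TotallyBounded F) :
    ∀ᵐ ω ∂μ, lowerBoxDim F - max 0 (quasiAssouadDim F - s) ≤ lowerBoxDim (f ω '' F) := by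
  filter_upwards [hf.ae_forall_rat_eventually_coverNum_le hs hF] with ω hω
  exact sub_le_of_forall_rat_gt fun q hq => lowerBoxDim_le_add (hω q hq)

end BoxDimension

/-! ### Packing dimension -/

section PackingDimension

variable {ι : Type*} [Countable ι]

theorem packingDim_le_iSup [PseudoEMetricSpace X] {A : Set X} {K : ι → Set X}
    (hK : ∀ i, IsCompact (K i)) (hA : A ⊆ ⋃ i, K i) : packingDim A ≤ ⨆ i, upperBoxDim (K i) := by
  obtain ⟨e, he⟩ := exists_surjective_nat (Option ι)
  let K' : Option ι → Set X := fun o => o.elim ∅ K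
  refine iInf_le_of_le (K' ∘ e)
    (iInf₂_le_of_le (fun j => ?_) (fun x hx => ?_) (iSup_le fun j => ?_))
  · rcases h : e j with _ | i
    · simp [K', h]
    · simpa [K', h] using hK i
  · obtain ⟨i, hi⟩ := mem_iUnion.1 (hA hx)
    obtain ⟨j, hj⟩ := he (some i)
    exact mem_iUnion.2 ⟨j, by simpa [K', hj] using hi⟩
  · rcases h : e j with _ | i
    · simp [K', h, upperBoxDim_empty]
    · simpa [K', h] using le_iSup (fun i => upperBoxDim (K i)) i

theorem packingDim_mono [PseudoEMetricSpace X] {A B : Set X} (h : A ⊆ B) :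
    packingDim A ≤ packingDim B :=
  le_iInf fun _ => le_iInf₂ fun hK hB => packingDim_le_iSup hK (h.trans hB)

theorem packingDim_empty [PseudoEMetricSpace X] : packingDim (∅ : Set X) = ⊥ :=
  le_bot_iff.1 <| (packingDim_le_iSup (K := fun i : Empty => i.elim) (fun i => i.elim)
    (empty_subset _)).trans_eq (iSup_of_empty _)

theorem packingDim_le_upperBoxDim [PseudoMetricSpace X] [ProperSpace X] {A : Set X}
    (hA : Bornology.IsBounded A) : packingDim A ≤ upperBoxDim A := by
  refine (packingDim_le_iSup (K := fun _ : Unit => closure A) (fun _ => hA.isCompact_closure)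
    (subset_closure.trans (iUnion_const _).ge)).trans ?_
  rw [iSup_const, upperBoxDim_closure]

theorem packingDim_iUnion_le [PseudoEMetricSpace X] (A : ι → Set X) :
    packingDim (⋃ i, A i) ≤ ⨆ i, packingDim (A i) := by
  refine le_of_forall_gt_imp_ge_of_dense fun c hc => ?_
  have hcover : ∀ i, ∃ K : ℕ → Set X, (∀ j, IsCompact (K j)) ∧ A i ⊆ ⋃ j, K j ∧
      ⨆ j, upperBoxDim (K j) < c := fun i => by
    simpa only [packingDim, iInf_lt_iff, exists_prop] using (le_iSup _ i).trans_lt hc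
  choose K hK hA hKc using hcover
  refine (packingDim_le_iSup (K := fun p : ι × ℕ => K p.1 p.2) (fun p => hK _ _) ?_).trans
    (iSup_le fun p => (le_iSup (fun j => upperBoxDim (K p.1 j)) p.2).trans (hKc p.1).le)
  rw [iUnion_prod']
  exact iUnion_mono hA

theorem packingDim_image_le [PseudoEMetricSpace X] [PseudoEMetricSpace Y] {f : X → Y}
    (hf : LipschitzWith 1 f) (A : Set X) : packingDim (f '' A) ≤ packingDim A :=
  le_iInf fun K => le_iInf₂ fun hK hA =>
    (packingDim_le_iSup (fun j => (hK j).image hf.continuous)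
      ((image_mono hA).trans image_iUnion.subset)).trans
      (iSup_mono fun j => upperBoxDim_image_le hf (K j))

theorem packingDim_le_finrank {W : Type*} [NormedAddCommGroup W] [NormedSpace ℝ W]
    [FiniteDimensional ℝ W] (A : Set W) : packingDim A ≤ Module.finrank ℝ W := by
  have : ProperSpace W := FiniteDimensional.proper ℝ W
  refine (packingDim_le_iSup (fun j : ℕ => isCompact_closedBall (0 : W) j) ?_).trans
    (iSup_le fun j => upperBoxDim_le_finrank Metric.isBounded_closedBall)
  simp [Metric.iUnion_closedBall_nat]

end PackingDimension

section PackingKernel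

variable {Z : Type*} [TopologicalSpace Z] [PseudoEMetricSpace X] {f : Z → X} {t : EReal}

/-- The points of `Z` all of whose neighbourhoods have image of packing dimension greater than `t`.
Discarding the other points makes a lower bound on packing dimension local. -/
def packingKernel (f : Z → X) (t : EReal) : Set Z :=
  {z | ∀ U ∈ 𝓝 z, t < packingDim (f '' U)}

theorem isClosed_packingKernel : IsClosed (packingKernel f t) := by
  refine isOpen_compl_iff.1 (isOpen_iff_mem_nhds.2 fun z hz => ?_)
  simp only [packingKernel, mem_compl_iff, mem_ofPred_eq, not_forall, not_lt] at hz
  obtain ⟨U, hU, hUt⟩ := hz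
  filter_upwards [eventually_mem_nhds_iff.2 hU] with y hy hyK
  exact hUt.not_gt (hyK U hy)

variable [HereditarilyLindelofSpace Z]

theorem packingDim_image_compl_packingKernel_le :
    packingDim (f '' (packingKernel f t)ᶜ) ≤ t := by
  refine (HereditarilyLindelofSpace.isLindelof _).induction_on
    (p := fun A => packingDim (f '' A) ≤ t)
    (fun A B hAB hB => (packingDim_mono (image_mono hAB)).trans hB) (fun S hS hSt => ?_)
    fun z hz => ?_
  · have := hS.to_subtype
    rw [sUnion_eq_iUnion, image_iUnion]
    exact (packingDim_iUnion_le _).trans (iSup_le fun A => hSt A A.2)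
  · simp only [packingKernel, mem_compl_iff, mem_ofPred_eq, not_forall, not_lt] at hz
    obtain ⟨U, hU, hUt⟩ := hz
    exact ⟨U, mem_nhdsWithin_of_mem_nhds hU, hUt⟩

theorem lt_packingDim_image_inter_packingKernel {U : Set Z} (hU : t < packingDim (f '' U)) :
    t < packingDim (f '' (U ∩ packingKernel f t)) := by
  have hsub : f '' U ⊆ ⋃ b : Bool, cond b (f '' (U ∩ packingKernel f t))
      (f '' (packingKernel f t)ᶜ) := by
    rw [← union_eq_iUnion, ← image_union]
    exact image_mono fun z hz => (em (z ∈ packingKernel f t)).imp (⟨hz, ·⟩) id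
  obtain ⟨b, hb⟩ := lt_iSup_iff.1
    (hU.trans_le ((packingDim_mono hsub).trans (packingDim_iUnion_le _)))
  cases b
  · exact absurd hb packingDim_image_compl_packingKernel_le.not_gt
  · exact hb

end PackingKernel

section Localization

theorem exists_polishSpace_forall_lt_packingDim [PseudoMetricSpace X] {F : Set X}
    (hF : AnalyticSet F) {t : EReal} (ht : t < packingDim F) :
    ∃ (Z : Type) (_ : TopologicalSpace Z) (φ : Z → X), PolishSpace Z ∧ Nonempty Z ∧
      Continuous φ ∧ range φ ⊆ F ∧
      ∀ U : Set Z, IsOpen U → U.Nonempty → t < packingDim (φ '' U) := by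
  obtain ⟨Z, _, _, φ, hφ, rfl⟩ := analyticSet_iff_exists_polishSpace_range.1 hF
  refine ⟨packingKernel φ t, inferInstance, φ ∘ (↑), isClosed_packingKernel.polishSpace, ?_,
    hφ.comp continuous_subtype_val, range_comp_subset_range _ _, ?_⟩
  · rw [← image_univ] at ht
    refine nonempty_coe_sort.2 (nonempty_iff_ne_empty.2 fun hempty => ?_)
    have h := lt_packingDim_image_inter_packingKernel ht
    rw [hempty, inter_empty, image_empty, packingDim_empty] at h
    exact not_lt_bot h
  · rintro _ ⟨U, hU, rfl⟩ ⟨z, hz⟩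
    rw [image_comp, Subtype.image_preimage_coe, inter_comm]
    exact lt_packingDim_image_inter_packingKernel (z.2 U (hU.mem_nhds hz))

theorem le_packingDim_of_forall_isOpen {Z : Type*} [TopologicalSpace Z] [BaireSpace Z] [Nonempty Z]
    [PseudoEMetricSpace Y] [T2Space Y] {g : Z → Y} (hg : Continuous g) {t : EReal}
    (h : ∀ U, IsOpen U → U.Nonempty → t ≤ upperBoxDim (g '' U)) : t ≤ packingDim (range g) := by
  refine le_iInf fun K => le_iInf₂ fun hK hcov => ?_
  obtain ⟨j, hj⟩ := nonempty_interior_of_iUnion_of_closed (f := fun j => g ⁻¹' K j)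
    (fun j => (hK j).isClosed.preimage hg)
    (eq_univ_of_forall fun z => by simpa using hcov (mem_range_self z))
  calc t ≤ upperBoxDim (g '' interior (g ⁻¹' K j)) := h _ isOpen_interior hj
    _ ≤ upperBoxDim (K j) := upperBoxDim_mono (image_subset_iff.2 interior_subset)
    _ ≤ ⨆ j, upperBoxDim (K j) := le_iSup (fun j => upperBoxDim (K j)) j

end Localization

section Transversal

variable [PseudoMetricSpace X] [ProperSpace X] [MetricSpace Y] {Ω : Type*} [MeasurableSpace Ω]
  {μ : Measure Ω} [IsFiniteMeasure μ] {f : Ω → X → Y} {F : Set X} {s : ℝ}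

theorem IsTransversal.ae_sub_le_packingDim_range {Z : Type*} [TopologicalSpace Z]
    [SecondCountableTopology Z] [BaireSpace Z] [Nonempty Z] (hf : IsTransversal μ f s) (hs : 0 ≤ s)
    (hcont : ∀ ω, Continuous (f ω)) {φ : Z → X} (hφ : Continuous φ) {t : EReal}
    (ht : ∀ U, IsOpen U → U.Nonempty → t ≤ packingDim (φ '' U)) :
    ∀ᵐ ω ∂μ, t - max 0 (quasiAssouadDim (range φ) - s) ≤ packingDim (range (f ω ∘ φ)) := by
  have hB := TopologicalSpace.isBasis_countableBasis Z
  have hae : ∀ᵐ ω ∂μ, ∀ b ∈ TopologicalSpace.countableBasis Z, TotallyBounded (φ '' b) →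
      upperBoxDim (φ '' b) - max 0 (quasiAssouadDim (φ '' b) - s) ≤
        upperBoxDim (f ω '' (φ '' b)) :=
    (ae_ball_iff (TopologicalSpace.countable_countableBasis Z)).2 fun _ _ =>
      eventually_imp_distrib_left.2 (hf.ae_sub_le_upperBoxDim hs)
  filter_upwards [hae] with ω hω
  refine le_packingDim_of_forall_isOpen ((hcont ω).comp hφ) fun U hU ⟨z, hz⟩ => ?_
  obtain ⟨b, hb, hzb, hbU⟩ := hB.exists_subset_of_mem_open
    (u := U ∩ φ ⁻¹' Metric.ball (φ z) 1) ⟨hz, by simp⟩ (hU.inter (Metric.isOpen_ball.preimage hφ))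
  have hbdd : Bornology.IsBounded (φ '' b) :=
    Metric.isBounded_ball.subset (image_subset_iff.2 fun x hx => (hbU hx).2)
  calc t - max 0 (quasiAssouadDim (range φ) - s)
      ≤ upperBoxDim (φ '' b) - max 0 (quasiAssouadDim (φ '' b) - s) :=
        EReal.sub_le_sub ((ht b (hB.isOpen hb) ⟨z, hzb⟩).trans (packingDim_le_upperBoxDim hbdd))
          (max_le_max le_rfl (EReal.sub_le_sub (quasiAssouadDim_mono (image_subset_range _ _))
            le_rfl))
    _ ≤ upperBoxDim (f ω '' (φ '' b)) :=
        hω b hb (hbdd.isCompact_closure.totallyBounded.subset subset_closure)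
    _ ≤ upperBoxDim (f ω ∘ φ '' U) := by
        rw [image_comp]
        exact upperBoxDim_mono (image_mono (image_mono fun x hx => (hbU hx).1))

theorem IsTransversal.ae_sub_le_packingDim_of_lt (hf : IsTransversal μ f s) (hs : 0 ≤ s)
    (hcont : ∀ ω, Continuous (f ω)) (hF : AnalyticSet F) {t : EReal} (ht : t < packingDim F) :
    ∀ᵐ ω ∂μ, t - max 0 (quasiAssouadDim F - s) ≤ packingDim (f ω '' F) := by
  obtain ⟨Z, _, φ, _, _, hφ, hφF, hopen⟩ := exists_polishSpace_forall_lt_packingDim hF ht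
  filter_upwards [hf.ae_sub_le_packingDim_range hs hcont hφ fun U hU hne => (hopen U hU hne).le]
    with ω hω
  calc t - max 0 (quasiAssouadDim F - s) ≤ t - max 0 (quasiAssouadDim (range φ) - s) :=
        EReal.sub_le_sub le_rfl (max_le_max le_rfl
          (EReal.sub_le_sub (quasiAssouadDim_mono hφF) le_rfl))
    _ ≤ packingDim (range (f ω ∘ φ)) := hω
    _ ≤ packingDim (f ω '' F) := by
        rw [range_comp]
        exact packingDim_mono (image_mono hφF)

theorem IsTransversal.ae_sub_le_packingDim (hf : IsTransversal μ f s) (hs : 0 ≤ s)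
    (hcont : ∀ ω, Continuous (f ω)) (hF : AnalyticSet F) :
    ∀ᵐ ω ∂μ, packingDim F - max 0 (quasiAssouadDim F - s) ≤ packingDim (f ω '' F) := by
  have hrat : ∀ᵐ ω ∂μ, ∀ q : ℚ, ((q : ℝ) : EReal) < packingDim F →
      ((q : ℝ) : EReal) - max 0 (quasiAssouadDim F - s) ≤ packingDim (f ω '' F) :=
    ae_all_iff.2 fun _ => eventually_imp_distrib_left.2
      (hf.ae_sub_le_packingDim_of_lt hs hcont hF)
  filter_upwards [hrat] with ω hω
  exact sub_le_of_forall_rat_lt hω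

end Transversal

/-! ### Transversality of orthogonal projections -/

section Grassmannian

variable {n m : ℕ} {ε : ℝ}

theorem norm_starProjection_rotate (g : O n) (V : Gr n m) (z : E n) :
    ‖(rotate g V).1.starProjection z‖ = ‖V.1.starProjection (star (g : E n →L[ℝ] E n) z)‖ := by
  rw [starProjection_rotate]
  exact Unitary.norm_map g _

theorem continuous_starProjection_apply :
    Continuous fun p : Gr n m × E n => p.1.1.starProjection p.2 := by
  have h : Continuous fun V : Gr n m => V.1.starProjection := continuous_induced_dom
  exact (h.comp continuous_fst).clm_apply continuous_snd

theorem continuous_norm_starProjection (z : E n) :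
    Continuous fun V : Gr n m => ‖V.1.starProjection z‖ :=
  (continuous_starProjection_apply.comp (by fun_prop : Continuous fun V => (V, z))).norm

theorem exists_unitary_apply_eq {z w : E n} (h : ‖z‖ = ‖w‖) :
    ∃ g : O n, (g : E n →L[ℝ] E n) z = w :=
  ⟨Unitary.linearIsometryEquiv.symm (Submodule.reflection (ℝ ∙ (z - w))ᗮ),
    Submodule.reflection_sub h⟩

theorem grMeasure_setOf_norm_starProjection_le_eq (h : m ≤ n) {z w : E n} (hz : z ≠ 0) (hw : w ≠ 0)
    (ε : ℝ) : grMeasure h {V | ‖V.1.starProjection z‖ ≤ ε * ‖z‖} =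
      grMeasure h {V | ‖V.1.starProjection w‖ ≤ ε * ‖w‖} := by
  set t := ‖w‖ / ‖z‖
  have ht : 0 < t := div_pos (norm_pos_iff.2 hw) (norm_pos_iff.2 hz)
  have hwz : ‖w‖ = t * ‖z‖ := (div_mul_cancel₀ _ (norm_ne_zero_iff.2 hz)).symm
  obtain ⟨g, hg⟩ := exists_unitary_apply_eq (z := w) (w := t • z)
    (by rw [norm_smul, Real.norm_of_nonneg ht.le, hwz])
  have hrotate : rotate (star g) ⁻¹' {V | ‖V.1.starProjection w‖ ≤ ε * ‖w‖} =
      {V : Gr n m | ‖V.1.starProjection z‖ ≤ ε * ‖z‖} := by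
    ext V
    rw [mem_preimage, mem_ofPred_eq, norm_starProjection_rotate, Unitary.coe_star, star_star, hg,
      map_smul, norm_smul, Real.norm_of_nonneg ht.le, hwz, mul_left_comm, mul_le_mul_iff_right₀ ht]
    rfl
  rw [← hrotate, ← Measure.map_apply (continuous_rotate_right (star g)).measurable
    (isClosed_le (continuous_norm_starProjection w) continuous_const).measurableSet,
    map_rotate_grMeasure]

/-- The points of the open unit ball that are `0` or whose angle with `Vᗮ` has sine at most `ε`. -/
def slab (V : Submodule ℝ (E n)) (ε : ℝ) : Set (E n) :=
  {w ∈ Metric.ball 0 1 | ‖V.starProjection w‖ ≤ ε * ‖w‖}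

theorem volume_slab_rotate (g : O n) (V : Gr n m) (ε : ℝ) :
    volume (slab (rotate g V).1 ε) = volume (slab V.1 ε) := by
  let e := Unitary.linearIsometryEquiv (star g)
  conv_rhs => rw [← (show MeasurePreserving e.toMeasurableEquiv volume volume from
    e.measurePreserving).measure_preimage_equiv]
  congr 1 with w
  have he : star (g : E n →L[ℝ] E n) w = e w := rfl
  simp only [slab, mem_preimage, mem_ofPred_eq, mem_ball_zero_iff, norm_starProjection_rotate,
    LinearIsometryEquiv.coe_toMeasurableEquiv, e.norm_map, he]

theorem starProjection_coordSubspace_apply (h : m ≤ n) (z : E n) (i : Fin m) :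
    (coordSubspace h).1.starProjection z (Fin.castLE h i) = z (Fin.castLE h i) := by
  have hmem : (EuclideanSpace.single (Fin.castLE h i) (1 : ℝ) : E n) ∈ (coordSubspace h).1 :=
    Submodule.subset_span ⟨i, rfl⟩
  have hinner := (coordSubspace h).1.starProjection_inner_eq_zero z _ hmem
  rw [EuclideanSpace.inner_single_right] at hinner
  simp only [PiLp.sub_apply, map_sub, conj_trivial, one_mul] at hinner
  linarith

theorem slab_coordSubspace_subset (h : m ≤ n) (hε : 0 ≤ ε) :
    slab (coordSubspace h).1 ε ⊆ (MeasurableEquiv.toLp 2 (Fin n → ℝ)).symm ⁻¹' univ.pi fun i =>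
      Metric.closedBall 0 (if (i : ℕ) < m then ε else 1) := by
  rintro w ⟨hw1, hw⟩ i -
  rw [mem_ball_zero_iff] at hw1
  rw [mem_closedBall_zero_iff]
  change ‖w i‖ ≤ _
  split_ifs with hi
  · calc ‖w i‖ = ‖(coordSubspace h).1.starProjection w i‖ :=
          congrArg norm (starProjection_coordSubspace_apply h w ⟨i, hi⟩).symm
      _ ≤ ε * ‖w‖ := (PiLp.norm_apply_le _ i).trans hw
      _ ≤ ε := mul_le_of_le_one_right hε hw1.le
  · exact (PiLp.norm_apply_le w i).trans hw1.le

theorem volume_slab_coordSubspace_le (h : m ≤ n) (hε : 0 ≤ ε) :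
    volume (slab (coordSubspace h).1 ε) ≤ ENNReal.ofReal (2 ^ n * ε ^ m) := by
  have hside : ∀ i : Fin n, (0 : ℝ) ≤ 2 * if (i : ℕ) < m then ε else 1 := fun i => by positivity
  refine (measure_mono (slab_coordSubspace_subset h hε)).trans_eq ?_
  rw [(EuclideanSpace.volume_preserving_symm_measurableEquiv_toLp (Fin n)).measure_preimage_equiv,
    volume_pi_pi]
  simp only [Real.volume_closedBall]
  rw [← ENNReal.ofReal_prod_of_nonneg fun i _ => hside i, Finset.prod_mul_distrib,
    Finset.prod_ite]
  simp [Fin.card_filter_val_lt, h]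

theorem lintegral_volume_slab_le (h : m ≤ n) (hε : 0 ≤ ε) :
    ∫⁻ V, volume (slab V.1 ε) ∂(grMeasure h) ≤ ENNReal.ofReal (2 ^ n * ε ^ m) := by
  refine (lintegral_map_le _ _).trans ?_
  simp only [volume_slab_rotate, lintegral_const]
  rw [← TopologicalSpace.PositiveCompacts.coe_top, Measure.haarMeasure_self, mul_one]
  exact volume_slab_coordSubspace_le h hε

theorem grMeasure_setOf_norm_starProjection_le_mul_volume_ball_le (h : m ≤ n) {z : E n} (hz : z ≠ 0)
    (hε : 0 ≤ ε) : grMeasure h {V | ‖V.1.starProjection z‖ ≤ ε * ‖z‖} *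
      volume (Metric.ball (0 : E n) 1) ≤ ENNReal.ofReal (2 ^ n * ε ^ m) := by
  have : Nontrivial (E n) := ⟨z, 0, hz⟩
  let S : Set (Gr n m × E n) := {p | p.2 ∈ slab p.1.1 ε}
  have hS : MeasurableSet S :=
    (Metric.isOpen_ball.preimage continuous_snd).measurableSet.inter
      (isClosed_le continuous_starProjection_apply.norm (by fun_prop)).measurableSet
  calc grMeasure h {V | ‖V.1.starProjection z‖ ≤ ε * ‖z‖} * volume (Metric.ball (0 : E n) 1)
      = ∫⁻ w in Metric.ball 0 1, grMeasure h {V | ‖V.1.starProjection w‖ ≤ ε * ‖w‖} := by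
        rw [← setLIntegral_const]
        refine lintegral_congr_ae (ae_restrict_of_ae ?_)
        filter_upwards [measure_eq_zero_iff_ae_notMem.1 (measure_singleton (0 : E n))] with w hw
        exact grMeasure_setOf_norm_starProjection_le_eq h hz hw ε
    _ ≤ ∫⁻ w, grMeasure h {V | w ∈ slab V.1 ε} := by
        rw [← lintegral_indicator Metric.isOpen_ball.measurableSet]
        exact lintegral_mono (indicator_le fun w hw => measure_mono fun V hV => ⟨hw, hV⟩)
    _ = ∫⁻ V, volume (slab V.1 ε) ∂(grMeasure h) := by
        exact (Measure.prod_apply_symm hS).symm.trans (Measure.prod_apply hS)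
    _ ≤ ENNReal.ofReal (2 ^ n * ε ^ m) := lintegral_volume_slab_le h hε

theorem isTransversal_starProjection (h : m ≤ n) :
    IsTransversal (grMeasure h) (fun V x => V.1.starProjection x) m := by
  refine ⟨fun x y => ?_, 2 ^ n / volume.real (Metric.ball (0 : E n) 1), fun x y hxy δ hδ => ?_⟩
  · simp only [dist_eq_norm, ← map_sub]
    exact (continuous_norm_starProjection _).measurable
  · have hball : 0 < volume.real (Metric.ball (0 : E n) 1) :=
      ENNReal.toReal_pos (Metric.measure_ball_pos _ _ one_pos).ne' measure_ball_lt_top.ne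
    have hle := grMeasure_setOf_norm_starProjection_le_mul_volume_ball_le h
      (sub_ne_zero.2 (dist_pos.1 hxy)) (ε := δ / dist x y) (by positivity)
    simp only [← map_sub, dist_eq_norm] at hxy hle ⊢
    rw [div_mul_cancel₀ _ hxy.ne'] at hle
    rw [Real.rpow_natCast, div_mul_eq_mul_div, le_div_iff₀ hball, measureReal_def, measureReal_def,
      ← ENNReal.toReal_mul]
    exact ENNReal.toReal_le_of_le_ofReal (by positivity) hle

end Grassmannian

/-! ### Dimensions of orthogonal projections -/

section Projections

variable {n m : ℕ} {F : Set (E n)}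

theorem ae_sub_le_upperBoxDim_proj (h : m ≤ n) (hF : Bornology.IsBounded F) :
    ∀ᵐ V ∂(grMeasure h), upperBoxDim F - max 0 (quasiAssouadDim F - m) ≤ upperBoxDim (proj V F) :=
  (isTransversal_starProjection h).ae_sub_le_upperBoxDim m.cast_nonneg
    (hF.isCompact_closure.totallyBounded.subset subset_closure)

theorem ae_sub_le_lowerBoxDim_proj (h : m ≤ n) (hF : Bornology.IsBounded F) :
    ∀ᵐ V ∂(grMeasure h), lowerBoxDim F - max 0 (quasiAssouadDim F - m) ≤ lowerBoxDim (proj V F) :=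
  (isTransversal_starProjection h).ae_sub_le_lowerBoxDim m.cast_nonneg
    (hF.isCompact_closure.totallyBounded.subset subset_closure)

theorem ae_sub_le_packingDim_proj (h : m ≤ n) (hF : AnalyticSet F) :
    ∀ᵐ V ∂(grMeasure h), packingDim F - max 0 (quasiAssouadDim F - m) ≤ packingDim (proj V F) :=
  (isTransversal_starProjection h).ae_sub_le_packingDim m.cast_nonneg
    (fun V => V.1.starProjection.continuous) hF

theorem lipschitzWith_starProjection (V : Submodule ℝ (E n)) : LipschitzWith 1 V.starProjection :=
  V.starProjection.lipschitz.weaken (by exact_mod_cast V.starProjection_norm_le)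

theorem upperBoxDim_image_starProjection_le_finrank (V : Submodule ℝ (E n))
    (hF : Bornology.IsBounded F) : upperBoxDim (V.starProjection '' F) ≤ Module.finrank ℝ V := by
  have himage : V.starProjection '' F = V.subtypeₗᵢ '' (V.orthogonalProjectionOnto '' F) :=
    image_comp V.subtypeₗᵢ V.orthogonalProjectionOnto F
  rw [himage]
  exact (upperBoxDim_image_le V.subtypeₗᵢ.lipschitz _).trans
    (upperBoxDim_le_finrank (V.orthogonalProjectionOnto.lipschitz.isBounded_image hF))

theorem packingDim_image_starProjection_le_finrank (V : Submodule ℝ (E n)) (F : Set (E n)) :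
    packingDim (V.starProjection '' F) ≤ Module.finrank ℝ V := by
  have himage : V.starProjection '' F = V.subtypeₗᵢ '' (V.orthogonalProjectionOnto '' F) :=
    image_comp V.subtypeₗᵢ V.orthogonalProjectionOnto F
  rw [himage]
  exact (packingDim_image_le V.subtypeₗᵢ.lipschitz _).trans (packingDim_le_finrank _)

theorem upperBoxDim_proj_le (V : Gr n m) (hF : Bornology.IsBounded F) :
    upperBoxDim (proj V F) ≤ min (m : EReal) (upperBoxDim F) :=
  le_min ((upperBoxDim_image_starProjection_le_finrank V.1 hF).trans_eq (by rw [V.2]))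
    (upperBoxDim_image_le (lipschitzWith_starProjection V.1) F)

theorem lowerBoxDim_proj_le (V : Gr n m) (hF : Bornology.IsBounded F) :
    lowerBoxDim (proj V F) ≤ min (m : EReal) (lowerBoxDim F) :=
  le_min ((lowerBoxDim_le_upperBoxDim _).trans ((upperBoxDim_proj_le V hF).trans (min_le_left _ _)))
    (lowerBoxDim_image_le (lipschitzWith_starProjection V.1) F)

theorem packingDim_proj_le (V : Gr n m) (F : Set (E n)) :
    packingDim (proj V F) ≤ min (m : EReal) (packingDim F) :=
  le_min ((packingDim_image_starProjection_le_finrank V.1 F).trans_eq (by rw [V.2]))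
    (packingDim_image_le (lipschitzWith_starProjection V.1) F)

theorem upperBoxDim_lt_top (hF : Bornology.IsBounded F) : upperBoxDim F < ⊤ :=
  (upperBoxDim_le_finrank hF).trans_lt (EReal.natCast_ne_top _).lt_top

theorem lowerBoxDim_lt_top (hF : Bornology.IsBounded F) : lowerBoxDim F < ⊤ :=
  (lowerBoxDim_le_upperBoxDim F).trans_lt (upperBoxDim_lt_top hF)

theorem packingDim_lt_top (F : Set (E n)) : packingDim F < ⊤ :=
  (packingDim_le_finrank F).trans_lt (EReal.natCast_ne_top _).lt_top

end Projections

end ProjDim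

theorem corollary1p3_general {n m : ℕ} (h : m ≤ n) (F : Set (EuclideanSpace ℝ (Fin n))) :
    (Bornology.IsBounded F →
      (ProjDim.quasiAssouadDim F ≤ max (m : EReal) (ProjDim.upperBoxDim F) →
        ∀ᵐ V ∂(ProjDim.grMeasure h),
          ProjDim.upperBoxDim (ProjDim.proj V F) = min (m : EReal) (ProjDim.upperBoxDim F)) ∧
      (∀ᵐ V ∂(ProjDim.grMeasure h),
          ProjDim.upperBoxDim (ProjDim.proj V F) ≥
            ProjDim.upperBoxDim F - max 0 (ProjDim.quasiAssouadDim F - (m : EReal))) ∧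
      (ProjDim.quasiAssouadDim F ≤ max (m : EReal) (ProjDim.lowerBoxDim F) →
        ∀ᵐ V ∂(ProjDim.grMeasure h),
          ProjDim.lowerBoxDim (ProjDim.proj V F) = min (m : EReal) (ProjDim.lowerBoxDim F)) ∧
      (∀ᵐ V ∂(ProjDim.grMeasure h),
          ProjDim.lowerBoxDim (ProjDim.proj V F) ≥
            ProjDim.lowerBoxDim F - max 0 (ProjDim.quasiAssouadDim F - (m : EReal)))) ∧
    (AnalyticSet F →
      (ProjDim.quasiAssouadDim F ≤ max (m : EReal) (ProjDim.packingDim F) →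
        ∀ᵐ V ∂(ProjDim.grMeasure h),
          ProjDim.packingDim (ProjDim.proj V F) = min (m : EReal) (ProjDim.packingDim F)) ∧
      (∀ᵐ V ∂(ProjDim.grMeasure h),
          ProjDim.packingDim (ProjDim.proj V F) ≥
            ProjDim.packingDim F - max 0 (ProjDim.quasiAssouadDim F - (m : EReal)))) := by
  refine ⟨fun hb => ?_, fun hF => ?_⟩
  · have hupper := ProjDim.ae_sub_le_upperBoxDim_proj h hb
    have hlower := ProjDim.ae_sub_le_lowerBoxDim_proj h hb
    refine ⟨fun hq => ?_, hupper, fun hq => ?_, hlower⟩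
    · filter_upwards [hupper] with V hV
      exact (ProjDim.upperBoxDim_proj_le V hb).antisymm
        ((ProjDim.min_le_sub_max_sub (ProjDim.upperBoxDim_lt_top hb) hq).trans hV)
    · filter_upwards [hlower] with V hV
      exact (ProjDim.lowerBoxDim_proj_le V hb).antisymm
        ((ProjDim.min_le_sub_max_sub (ProjDim.lowerBoxDim_lt_top hb) hq).trans hV)
  · have hpacking := ProjDim.ae_sub_le_packingDim_proj h hF
    refine ⟨fun hq => ?_, hpacking⟩
    filter_upwards [hpacking] with V hV
    exact (ProjDim.packingDim_proj_le V F).antisymm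
      ((ProjDim.min_le_sub_max_sub (ProjDim.packingDim_lt_top F) hq).trans hV)

theorem corollary1p3 (n m : ℕ) (hm : 1 ≤ m) (hmn : m < n)
    (F : Set (EuclideanSpace ℝ (Fin n))) (hF : F.Nonempty) :
    -- box dimensions of bounded sets
    (Bornology.IsBounded F →
      -- upper box dimension
      (ProjDim.quasiAssouadDim F ≤ max (m : EReal) (ProjDim.upperBoxDim F) →
        ∀ᵐ V ∂(ProjDim.grMeasure hmn.le),
          ProjDim.upperBoxDim (ProjDim.proj V F) = min (m : EReal) (ProjDim.upperBoxDim F)) ∧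
      (∀ᵐ V ∂(ProjDim.grMeasure hmn.le),
          ProjDim.upperBoxDim (ProjDim.proj V F) ≥
            ProjDim.upperBoxDim F - max 0 (ProjDim.quasiAssouadDim F - (m : EReal))) ∧
      -- lower box dimension
      (ProjDim.quasiAssouadDim F ≤ max (m : EReal) (ProjDim.lowerBoxDim F) →
        ∀ᵐ V ∂(ProjDim.grMeasure hmn.le),
          ProjDim.lowerBoxDim (ProjDim.proj V F) = min (m : EReal) (ProjDim.lowerBoxDim F)) ∧
      (∀ᵐ V ∂(ProjDim.grMeasure hmn.le),
          ProjDim.lowerBoxDim (ProjDim.proj V F) ≥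
            ProjDim.lowerBoxDim F - max 0 (ProjDim.quasiAssouadDim F - (m : EReal)))) ∧
    -- packing dimension of Borel sets, bounded or not
    (MeasurableSet F →
      (ProjDim.quasiAssouadDim F ≤ max (m : EReal) (ProjDim.packingDim F) →
        ∀ᵐ V ∂(ProjDim.grMeasure hmn.le),
          ProjDim.packingDim (ProjDim.proj V F) = min (m : EReal) (ProjDim.packingDim F)) ∧
      (∀ᵐ V ∂(ProjDim.grMeasure hmn.le),
          ProjDim.packingDim (ProjDim.proj V F) ≥
            ProjDim.packingDim F - max 0 (ProjDim.quasiAssouadDim F - (m : EReal)))) := by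
  have hgeneral := corollary1p3_general hmn.le F
  exact ⟨hgeneral.1, fun hF' => hgeneral.2 hF'.analyticSet⟩
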